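/- Let $n\ge 3$ be an odd integer, put $m=\frac{n-1}{2}$, and let $k$ be a field with $\operatorname{char} k\nmid 2n^2$ containing a primitive $n$-th root of unity $q$. Let $H_{2n^2}$ be the Hopf algebra over $k$ generated as an associative algebra by $x,y,z$ with relations $$x^n=y^n=1,\quad xy=yx,\quad zx=yz,\quad zy=xz,\quad z^2=\frac1n\sum_{i,j=0}^{n-1}q^{-ij}x^iy^j,$$ with comultiplication $\Delta(x)=x\otimes x$, $\Delta(y)=y\otimes y$, $\Delta(z)=\frac1n\sum_{i,j=0}^{n-1}q^{-ij}x^iz\otimes y^jz$, counit $\varepsilon(x)=\varepsilon(y)=\varepsilon(z)=1$, and antipode $S(x)=x^{-1}$, $S(y)=y^{-1}$, $S(z)=z$. Let $r(H_{2n^2})$ be its Grothendieck ring: the quotient of the free abelian group on the isomorphism classes $[M]$ of finite-dimensional $H_{2n^2}$-modules, with multiplication $[M][N]=[M\otimes N]$, by the relations $[Y]=[X]+[Z]$ for all short exact sequences $0\to X\to Y\to Z\to 0$. Let $S_{n+1}$ be the one-dimensional module on which $x$ and $y$ act as $q^{n+1}=q$ and $z$ acts as $-q^{(n+1)^2/2}$,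 and let $S_{0,1}$ be the two-dimensional module on which $x,y,z$ act by the matrices $$\begin{pmatrix}1&0\\0&q\end{pmatrix},\qquad \begin{pmatrix}q&0\\0&1\end{pmatrix},\qquad \begin{pmatrix}0&1\\1&0\end{pmatrix}$$ respectively. Define $F_t(y,z)\in\mathbb Z[y,z]$ by $F_0=0$, $F_1=1$ and $F_{t+2}=zF_{t+1}-yF_t$ for $t\ge 0$. Then there is a ring isomorphism $\mathbb Z[y,z]/I\to r(H_{2n^2})$ with $y\mapsto [S_{n+1}]$ and $z\mapsto [S_{0,1}]$, where $I$ is the ideal generated by $$y^{2n}-1,\qquad zy^n-z,$$ and $$z^{m+1}-z^my^{m+1}+\sum_{i=1}^{\lfloor (m+1)/2\rfloor}(-1)^i\binom{m+1-i}{i}y^iz^{m+1-2i}-\sum_{i=1}^{\lfloor m/2\rfloor}(-1)^i\binom{m-i}{i}y^{m+1+i}z^{m-2i}-y^{n+1}F_m(y,z)+y^{m+n+2}F_{m-1}(y,z).$$ -/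

import Mathlib

open scoped TensorProduct

/-! ## Finite-dimensional modules over a bialgebra and the Grothendieck ring -/

namespace HopfRep

universe u v

/-- A finite-dimensional module over the `k`-algebra `H`: a finite-dimensional `k`-vector space `V`
with an action of `H`, i.e. a `k`-algebra homomorphism `H → End_k(V)`. -/
structure FDMod (k : Type u) (H : Type v) [Field k] [Ring H] [Algebra k H] where
  V : Type u
  [addCommGroup : AddCommGroup V]
  [module : Module k V]
  [finite : Module.Finite k V]
  act : H →ₐ[k] Module.End k V

attribute [instance] FDMod.addCommGroup FDMod.module FDMod.finite

section Algebra

variable {k : Type u} {H : Type v} [Field k] [Ring H] [Algebra k H]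

/-- `f` is a homomorphism of `H`-modules. -/
def FDMod.IsHom (M N : FDMod k H) (f : M.V →ₗ[k] N.V) : Prop :=
  ∀ (h : H) (v : M.V), f (M.act h v) = N.act h (f v)

/-- Isomorphism of `H`-modules. -/
def FDMod.Iso (M N : FDMod k H) : Prop :=
  ∃ e : M.V ≃ₗ[k] N.V, M.IsHom N e.toLinearMap

/-- There is a short exact sequence `0 → X → Y → Z → 0` of `H`-modules. -/
def FDMod.ShortExact (X Y Z : FDMod k H) : Prop :=
  ∃ (f : X.V →ₗ[k] Y.V) (g : Y.V →ₗ[k] Z.V), X.IsHom Y f ∧ Y.IsHom Z g ∧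
    Function.Injective f ∧ Function.Surjective g ∧ Function.Exact f g

variable (k H) in
/-- Isomorphism as an equivalence relation on finite-dimensional modules. -/
instance FDMod.setoid : Setoid (FDMod k H) where
  r := FDMod.Iso
  iseqv :=
    { refl := fun _ => ⟨LinearEquiv.refl k _, fun _ _ => rfl⟩
      symm := by
        rintro M N ⟨e, he⟩
        refine ⟨e.symm, fun h v => ?_⟩
        apply e.injective
        have := he h (e.symm v)
        simp only [LinearEquiv.coe_coe, LinearEquiv.apply_symm_apply] at this ⊢
        exact this.symm
      trans := by
        rintro M N P ⟨e, he⟩ ⟨f, hf⟩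
        refine ⟨e.trans f, fun h v => ?_⟩
        have h1 := he h v
        have h2 := hf h (e v)
        simp only [LinearEquiv.coe_coe] at h1 h2
        simp only [LinearEquiv.coe_coe, LinearEquiv.trans_apply, h1, h2] }

variable (k H) in
/-- The isomorphism classes of finite-dimensional `H`-modules. -/
def IsoClass : Type _ := Quotient (FDMod.setoid k H)

end Algebra

section Bialgebra

variable {k : Type u} {H : Type v} [Field k] [Ring H] [Bialgebra k H]

section Action

variable {V V' W W' U : Type u} [AddCommGroup V] [Module k V] [AddCommGroup V'] [Module k V']
  [AddCommGroup W] [Module k W] [AddCommGroup W'] [Module k W'] [AddCommGroup U] [Module k U]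

/-- For actions `ρ` and `τ` of an algebra `A` on `V` and of `B` on `W`, the action
`a ⊗ b ↦ ρ a ⊗ τ b` of `A ⊗ B` on `V ⊗ W`. -/
noncomputable def extAct {A B : Type v} [Ring A] [Algebra k A] [Ring B] [Algebra k B]
    (ρ : A →ₐ[k] Module.End k V) (τ : B →ₐ[k] Module.End k W) :
    A ⊗[k] B →ₐ[k] Module.End k (V ⊗[k] W) :=
  (Module.endTensorEndAlgHom (R := k) (S := k) (A := k)).comp (Algebra.TensorProduct.map ρ τ)

@[simp]
theorem extAct_tmul {A B : Type v} [Ring A] [Algebra k A] [Ring B] [Algebra k B]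
    (ρ : A →ₐ[k] Module.End k V) (τ : B →ₐ[k] Module.End k W) (a : A) (b : B) (v : V) (w : W) :
    extAct ρ τ (a ⊗ₜ b) (v ⊗ₜ w) = ρ a v ⊗ₜ τ b w := by
  simp [extAct, Module.endTensorEndAlgHom_apply]

/-- The action `h ↦ ∑ h₁ ⊗ h₂` on a tensor product. -/
noncomputable def tensorAct (ρ : H →ₐ[k] Module.End k V) (τ : H →ₐ[k] Module.End k W) :
    H →ₐ[k] Module.End k (V ⊗[k] W) :=
  (extAct ρ τ).comp (Bialgebra.comulAlgHom k H)

theorem tensorAct_apply (ρ : H →ₐ[k] Module.End k V) (τ : H →ₐ[k] Module.End k W) (h : H) :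
    tensorAct ρ τ h = extAct ρ τ (Coalgebra.comul h) := rfl

variable (k H) in
/-- The action of `H` on `k` by the counit. -/
noncomputable def trivAct : H →ₐ[k] Module.End k k :=
  (Algebra.ofId k (Module.End k k)).comp (Bialgebra.counitAlgHom k H)

@[simp]
theorem trivAct_apply (h : H) (c : k) : trivAct k H h c = Coalgebra.counit (R := k) h * c := by
  simp [trivAct, Algebra.ofId_apply]

theorem tensorAct_congr {ρ : H →ₐ[k] Module.End k V} {ρ' : H →ₐ[k] Module.End k V'}
    {τ : H →ₐ[k] Module.End k W} {τ' : H →ₐ[k] Module.End k W'} (e : V ≃ₗ[k] V') (f : W ≃ₗ[k] W')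
    (he : ∀ h v, e (ρ h v) = ρ' h (e v)) (hf : ∀ h v, f (τ h v) = τ' h (f v)) (h : H)
    (v : V ⊗[k] W) :
    TensorProduct.congr e f (tensorAct ρ τ h v) =
      tensorAct ρ' τ' h (TensorProduct.congr e f v) := by
  rw [tensorAct_apply, tensorAct_apply]
  generalize (Coalgebra.comul h : H ⊗[k] H) = w
  induction w with
  | zero => simp
  | add a b ha hb => simp only [map_add, LinearMap.add_apply, ha, hb]
  | tmul a b =>
    induction v with
    | zero => simp
    | add x y hx hy => simp only [map_add, hx, hy]
    | tmul x y => simp [he, hf]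

theorem tensorAct_assoc (ρ : H →ₐ[k] Module.End k V) (τ : H →ₐ[k] Module.End k W)
    (υ : H →ₐ[k] Module.End k U) (h : H) (v : (V ⊗[k] W) ⊗[k] U) :
    TensorProduct.assoc k V W U (tensorAct (tensorAct ρ τ) υ h v) =
      tensorAct ρ (tensorAct τ υ) h (TensorProduct.assoc k V W U v) := by
  have hL : ∀ w : H ⊗[k] H, extAct (tensorAct ρ τ) υ w =
      extAct (extAct ρ τ) υ ((Coalgebra.comul (R := k) (A := H)).rTensor H w) := by
    intro w
    induction w with
    | zero => simp
    | add a b ha hb => simp only [map_add, ha, hb]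
    | tmul a b => rfl
  have hR : ∀ w : H ⊗[k] H, extAct ρ (tensorAct τ υ) w =
      extAct ρ (extAct τ υ) ((Coalgebra.comul (R := k) (A := H)).lTensor H w) := by
    intro w
    induction w with
    | zero => simp
    | add a b ha hb => simp only [map_add, ha, hb]
    | tmul a b => rfl
  rw [tensorAct_apply, tensorAct_apply, hL, hR, ← Coalgebra.coassoc_apply]
  generalize (Coalgebra.comul (R := k) (A := H)).rTensor H (Coalgebra.comul h) = w
  induction w with
  | zero => simp
  | add a b ha hb => simp only [map_add, LinearMap.add_apply, ha, hb]
  | tmul ab c =>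
    induction ab with
    | zero => simp
    | add a b ha hb => simp only [map_add, TensorProduct.add_tmul, LinearMap.add_apply, ha, hb]
    | tmul a b =>
      induction v with
      | zero => simp
      | add x y hx hy => simp only [map_add, hx, hy]
      | tmul xy z =>
        induction xy with
        | zero => simp
        | add x y hx hy => simp only [map_add, TensorProduct.add_tmul, hx, hy]
        | tmul x y => simp

theorem trivAct_tensorAct (ρ : H →ₐ[k] Module.End k V) (h : H) (v : k ⊗[k] V) :
    TensorProduct.lid k V (tensorAct (trivAct k H) ρ h v) = ρ h (TensorProduct.lid k V v) := by
  have key : ∀ w : H ⊗[k] H, TensorProduct.lid k V (extAct (trivAct k H) ρ w v) =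
      ρ (TensorProduct.lid k H ((Coalgebra.counit (R := k) (A := H)).rTensor H w))
        (TensorProduct.lid k V v) := by
    intro w
    induction w with
    | zero => simp
    | add a b ha hb => simp only [map_add, LinearMap.add_apply, ha, hb]
    | tmul a b =>
      induction v with
      | zero => simp
      | add x y hx hy => simp only [map_add, hx, hy]
      | tmul x y => simp [smul_smul, mul_comm]
  rw [tensorAct_apply, key, Coalgebra.rTensor_counit_comul]
  simp

theorem tensorAct_trivAct (ρ : H →ₐ[k] Module.End k V) (h : H) (v : V ⊗[k] k) :
    TensorProduct.rid k V (tensorAct ρ (trivAct k H) h v) = ρ h (TensorProduct.rid k V v) := by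
  have key : ∀ w : H ⊗[k] H, TensorProduct.rid k V (extAct ρ (trivAct k H) w v) =
      ρ (TensorProduct.rid k H ((Coalgebra.counit (R := k) (A := H)).lTensor H w))
        (TensorProduct.rid k V v) := by
    intro w
    induction w with
    | zero => simp
    | add a b ha hb => simp only [map_add, LinearMap.add_apply, ha, hb]
    | tmul a b =>
      induction v with
      | zero => simp
      | add x y hx hy => simp only [map_add, hx, hy]
      | tmul x y => simp [smul_smul, mul_comm]
  rw [tensorAct_apply, key, Coalgebra.lTensor_counit_comul]
  simp

end Action

/-- The tensor product of two `H`-modules. -/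
noncomputable def FDMod.tensor (M N : FDMod k H) : FDMod k H where
  V := M.V ⊗[k] N.V
  act := tensorAct M.act N.act

variable (k H) in
/-- The trivial module `k`, on which `H` acts by the counit. -/
noncomputable def FDMod.triv : FDMod k H where
  V := k
  act := trivAct k H

theorem FDMod.tensor_congr {M M' N N' : FDMod k H} (hM : M.Iso M') (hN : N.Iso N') :
    (M.tensor N).Iso (M'.tensor N') := by
  obtain ⟨e, he⟩ := hM
  obtain ⟨f, hf⟩ := hN
  exact ⟨TensorProduct.congr e f, tensorAct_congr e f he hf⟩

theorem FDMod.tensor_assoc (M N P : FDMod k H) :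
    ((M.tensor N).tensor P).Iso (M.tensor (N.tensor P)) :=
  ⟨TensorProduct.assoc k M.V N.V P.V, tensorAct_assoc M.act N.act P.act⟩

theorem FDMod.triv_tensor (M : FDMod k H) : ((FDMod.triv k H).tensor M).Iso M :=
  ⟨TensorProduct.lid k M.V, trivAct_tensorAct M.act⟩

theorem FDMod.tensor_triv (M : FDMod k H) : (M.tensor (FDMod.triv k H)).Iso M :=
  ⟨TensorProduct.rid k M.V, tensorAct_trivAct M.act⟩

/-- The isomorphism classes form a monoid under the tensor product, with unit the class of `k`. -/
noncomputable instance : Monoid (IsoClass k H) where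
  mul := Quotient.map₂ FDMod.tensor fun _ _ hM _ _ hN => FDMod.tensor_congr hM hN
  one := Quotient.mk _ (FDMod.triv k H)
  mul_assoc := by
    rintro ⟨M⟩ ⟨N⟩ ⟨P⟩
    exact Quotient.sound (FDMod.tensor_assoc M N P)
  one_mul := by
    rintro ⟨M⟩
    exact Quotient.sound (FDMod.triv_tensor M)
  mul_one := by
    rintro ⟨M⟩
    exact Quotient.sound (FDMod.tensor_triv M)

/-- The basis element `[M]` of the free abelian group `F(H)` on the isomorphism classes. The ring
structure on `F(H)` is the one with `[M][N] = [M ⊗ N]`. -/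
noncomputable def freeClass (M : FDMod k H) : FreeAbelianGroup (IsoClass k H) :=
  FreeAbelianGroup.of (Quotient.mk _ M)

variable (k H) in
/-- The relations `[Y] = [X] + [Z]` for all short exact sequences `0 → X → Y → Z → 0`. -/
inductive GrothendieckRel :
    FreeAbelianGroup (IsoClass k H) → FreeAbelianGroup (IsoClass k H) → Prop
  | ses (X Y Z : FDMod k H) (h : FDMod.ShortExact X Y Z) :
      GrothendieckRel (freeClass Y) (freeClass X + freeClass Z)

variable (k H) in
/-- The Grothendieck ring: the quotient ring of `F(H)` by the relations of short exact
sequences. -/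
def GrothendieckRing : Type _ := RingQuot (GrothendieckRel k H)

noncomputable instance : Ring (GrothendieckRing k H) :=
  inferInstanceAs (Ring (RingQuot (GrothendieckRel k H)))

/-- The class `[M]` in the Grothendieck ring. -/
noncomputable def cls (M : FDMod k H) : GrothendieckRing k H :=
  RingQuot.mkRingHom (GrothendieckRel k H) (freeClass M)

end Bialgebra

end HopfRep

/-! ## The Hopf algebra of dimension `2n²` -/

namespace HTwoNSq

universe u

section Twist

variable {k : Type u} [Field k] {A B : Type*} [Ring A] [Algebra k A] [Ring B] [Algebra k B]

/-- The element `(1/n) ∑_{i,j=0}^{n-1} q^{-ij} aⁱ bʲ`. -/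
def twist (n : ℕ) (q : k) (a b : A) : A :=
  (n : k)⁻¹ • ∑ i ∈ Finset.range n, ∑ j ∈ Finset.range n, (q⁻¹ ^ (i * j)) • (a ^ i * b ^ j)

theorem map_twist (f : A →ₐ[k] B) (n : ℕ) (q : k) (a b : A) :
    f (twist n q a b) = twist n q (f a) (f b) := by
  simp [twist]

theorem twist_semiconj {n : ℕ} {q : k} {w a a' b b' : A} (ha : SemiconjBy w a a')
    (hb : SemiconjBy w b b') : SemiconjBy w (twist n q a b) (twist n q a' b') := by
  simp only [SemiconjBy, twist, mul_smul_comm, smul_mul_assoc, Finset.mul_sum, Finset.sum_mul]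
  congr 1
  refine Finset.sum_congr rfl fun i _ => Finset.sum_congr rfl fun j _ => ?_
  congr 1
  exact ((ha.pow_right i).mul_right (hb.pow_right j)).eq

theorem twist_swap {n : ℕ} {q : k} {a b : A} (h : Commute a b) :
    twist n q a b = twist n q b a := by
  simp only [twist]
  rw [Finset.sum_comm]
  congr 1
  refine Finset.sum_congr rfl fun i _ => Finset.sum_congr rfl fun j _ => ?_
  rw [mul_comm, (h.pow_pow j i).eq]

/-- The element `(1/n) ∑_j q^{-ij} bʲ`. -/
def idem (n : ℕ) (q : k) (b : A) (i : ℕ) : A :=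
  (n : k)⁻¹ • ∑ j ∈ Finset.range n, (q⁻¹ ^ (i * j)) • b ^ j

theorem twist_eq (n : ℕ) (q : k) (a b : A) :
    twist n q a b = ∑ i ∈ Finset.range n, a ^ i * idem n q b i := by
  simp only [twist, idem, Finset.smul_sum, Finset.mul_sum, mul_smul_comm]

variable {n : ℕ} {q : k}

theorem cast_ne_zero (hn : 1 < n) (hq : IsPrimitiveRoot q n) : (n : k) ≠ 0 := by
  have : NeZero n := ⟨by omega⟩
  exact hq.neZero'.out

theorem root_ne_zero (hn : 1 < n) (hq : IsPrimitiveRoot q n) : q ≠ 0 :=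
  hq.ne_zero (by omega)

theorem mul_idem (hn : 1 < n) (hq : IsPrimitiveRoot q n) {b : A} (hb : b ^ n = 1) (i : ℕ) :
    b * idem n q b i = q ^ i • idem n q b i := by
  have h0 := root_ne_zero hn hq
  have hshift : ∑ j ∈ Finset.range n, (q⁻¹ ^ (i * (j + 1))) • b ^ (j + 1) =
      ∑ j ∈ Finset.range n, (q⁻¹ ^ (i * j)) • b ^ j := by
    have h1 := Finset.sum_range_succ (fun j => (q⁻¹ ^ (i * j)) • b ^ j) n
    have h2 := Finset.sum_range_succ' (fun j => (q⁻¹ ^ (i * j)) • b ^ j) n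
    have h3 : q⁻¹ ^ (i * n) = 1 := by rw [mul_comm, pow_mul, inv_pow, hq.pow_eq_one]; simp
    rw [h1] at h2
    simp only [h3, hb, mul_zero, pow_zero] at h2
    exact (add_right_cancel h2).symm
  have hterm : b * ∑ j ∈ Finset.range n, (q⁻¹ ^ (i * j)) • b ^ j =
      q ^ i • ∑ j ∈ Finset.range n, (q⁻¹ ^ (i * (j + 1))) • b ^ (j + 1) := by
    rw [Finset.smul_sum, Finset.mul_sum]
    refine Finset.sum_congr rfl fun j _ => ?_
    rw [smul_smul, mul_smul_comm, ← pow_succ']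
    congr 1
    rw [mul_add, mul_one, pow_add, mul_left_comm, ← mul_pow, mul_inv_cancel₀ h0, one_pow, mul_one]
  rw [idem, mul_smul_comm, hterm, hshift, smul_comm]

theorem pow_mul_idem (hn : 1 < n) (hq : IsPrimitiveRoot q n) {b : A} (hb : b ^ n = 1) (i j : ℕ) :
    b ^ j * idem n q b i = q ^ (i * j) • idem n q b i := by
  induction j with
  | zero => simp
  | succ j ih =>
    rw [pow_succ', mul_assoc, ih, mul_smul_comm, mul_idem hn hq hb, smul_smul, ← pow_add, mul_add,
      mul_one]

theorem sum_root (hn : 1 < n) (hq : IsPrimitiveRoot q n) {i l : ℕ} (hi : i < n) (hl : l < n) :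
    (n : k)⁻¹ * ∑ j ∈ Finset.range n, q⁻¹ ^ (i * j) * q ^ (l * j) = if i = l then 1 else 0 := by
  have h0 := root_ne_zero hn hq
  have h1 : ∀ j, q⁻¹ ^ (i * j) * q ^ (l * j) = (q⁻¹ ^ i * q ^ l) ^ j := by
    intro j
    rw [mul_pow, pow_mul, pow_mul]
  simp only [h1]
  split_ifs with h
  · subst h
    have : q⁻¹ ^ i * q ^ i = 1 := by rw [← mul_pow, inv_mul_cancel₀ h0, one_pow]
    simp only [this, one_pow, Finset.sum_const, Finset.card_range, nsmul_eq_mul, mul_one]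
    exact inv_mul_cancel₀ (cast_ne_zero hn hq)
  · have hne : q⁻¹ ^ i * q ^ l ≠ 1 := by
      intro h'
      apply h
      apply hq.pow_inj hi hl
      rw [inv_pow] at h'
      exact (eq_of_inv_mul_eq_one h')
    have hp : (q⁻¹ ^ i * q ^ l) ^ n = 1 := by
      rw [mul_pow, ← pow_mul, ← pow_mul, mul_comm i, mul_comm l, pow_mul, pow_mul, inv_pow,
        hq.pow_eq_one]
      simp
    have hg := mul_neg_geom_sum (q⁻¹ ^ i * q ^ l) n
    rw [hp, sub_self] at hg
    rcases mul_eq_zero.mp hg with hg | hg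
    · exact absurd (sub_eq_zero.mp hg).symm hne
    · rw [hg, mul_zero]

theorem idem_mul_idem (hn : 1 < n) (hq : IsPrimitiveRoot q n) {b : A} (hb : b ^ n = 1) {i l : ℕ}
    (hi : i < n) (hl : l < n) :
    idem n q b i * idem n q b l = if i = l then idem n q b l else 0 := by
  have h1 : idem n q b i * idem n q b l =
      ((n : k)⁻¹ * ∑ j ∈ Finset.range n, q⁻¹ ^ (i * j) * q ^ (l * j)) • idem n q b l := by
    rw [idem, smul_mul_assoc, Finset.sum_mul, mul_smul, Finset.sum_smul]
    congr 1
    refine Finset.sum_congr rfl fun j _ => ?_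
    rw [smul_mul_assoc, pow_mul_idem hn hq hb, smul_smul]
  rw [h1, sum_root hn hq hi hl]
  split_ifs <;> simp

theorem twist_mul_left (hn : 1 < n) (hq : IsPrimitiveRoot q n) {a a' b : A} (hb : b ^ n = 1)
    (haa : Commute a a') (hab : Commute a' b) :
    twist n q (a * a') b = twist n q a b * twist n q a' b := by
  have hc : ∀ i l, Commute (idem n q b i) (a' ^ l) := by
    intro i l
    refine ((Commute.sum_left _ _ _ fun j _ => ?_).smul_left _)
    exact ((hab.symm.pow_pow j l).smul_left _)
  rw [twist_eq, twist_eq, twist_eq, Finset.sum_mul_sum]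
  refine Finset.sum_congr rfl fun i hi => ?_
  rw [Finset.sum_eq_single i]
  · rw [mul_assoc (a ^ i), ← mul_assoc (idem n q b i), (hc i i).eq, mul_assoc (a' ^ i),
      idem_mul_idem hn hq hb (Finset.mem_range.mp hi) (Finset.mem_range.mp hi), if_pos rfl,
      haa.mul_pow, mul_assoc]
  · intro l hl hne
    rw [mul_assoc (a ^ i), ← mul_assoc (idem n q b i), (hc i l).eq, mul_assoc (a' ^ l),
      idem_mul_idem hn hq hb (Finset.mem_range.mp hi) (Finset.mem_range.mp hl), if_neg hne.symm]
    simp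
  · intro h
    exact absurd hi h

theorem twist_mul_right (hn : 1 < n) (hq : IsPrimitiveRoot q n) {a b b' : A} (ha : a ^ n = 1)
    (hbb : Commute b b') (hab : Commute a b) (hab' : Commute a b') :
    twist n q a (b * b') = twist n q a b * twist n q a b' := by
  rw [twist_swap (hab.mul_right hab'), twist_mul_left hn hq ha hbb hab'.symm,
    twist_swap hab.symm, twist_swap hab'.symm]

theorem twist_smul_one (hn : 1 < n) (hq : IsPrimitiveRoot q n) {a : A} {l : ℕ} (hl : l < n) :
    twist n q a (q ^ l • 1 : A) = a ^ l := by
  have h1 : ∀ i, idem n q (q ^ l • 1 : A) i =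
      ((n : k)⁻¹ * ∑ j ∈ Finset.range n, q⁻¹ ^ (i * j) * q ^ (l * j)) • (1 : A) := by
    intro i
    rw [idem, mul_smul, Finset.sum_smul]
    congr 1
    refine Finset.sum_congr rfl fun j _ => ?_
    rw [smul_pow, one_pow, smul_smul, ← pow_mul]
  rw [twist_eq, Finset.sum_eq_single l]
  · rw [h1, sum_root hn hq hl hl]; simp
  · intro i hi hne
    rw [h1, sum_root hn hq (Finset.mem_range.mp hi) hl]; simp [hne]
  · intro h
    exact absurd (Finset.mem_range.mpr hl) h

theorem twist_one_right (hn : 1 < n) (hq : IsPrimitiveRoot q n) (a : A) :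
    twist n q a 1 = 1 := by
  simpa using twist_smul_one hn hq (a := a) (l := 0) (by omega)

theorem twist_one_left (hn : 1 < n) (hq : IsPrimitiveRoot q n) (a : A) :
    twist n q 1 a = 1 := by
  rw [twist_swap (Commute.one_left a), twist_one_right hn hq]

theorem twist_pow_pow (hn : 1 < n) (hq : IsPrimitiveRoot q n) (i j : ℕ) :
    twist n q (q ^ i) (q ^ j) = q ^ (i * j) := by
  have h1 := twist_smul_one hn hq (a := q ^ i) (l := j % n) (Nat.mod_lt _ (by omega))
  have h2 : q ^ (j % n) = q ^ j := (pow_eq_pow_mod j hq.pow_eq_one).symm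
  rw [h2, smul_eq_mul, mul_one] at h1
  rw [h1, ← pow_mul]
  rw [mul_comm i (j % n), pow_mul, h2, ← pow_mul, mul_comm]

end Twist

section Presentation

variable {k : Type u} [Field k] {A B : Type*} [Ring A] [Algebra k A] [Ring B] [Algebra k B]

/-- The defining relations of `H_{2n²}` for three elements of a `k`-algebra:
`xⁿ = yⁿ = 1`, `xy = yx`, `zx = yz`, `zy = xz`, `z² = (1/n) ∑_{i,j} q^{-ij} xⁱ yʲ`. -/
structure Relations (n : ℕ) (q : k) (x y z : A) : Prop where
  x_pow : x ^ n = 1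
  y_pow : y ^ n = 1
  x_y : x * y = y * x
  z_x : z * x = y * z
  z_y : z * y = x * z
  z_sq : z ^ 2 = twist n q x y

/-- The three generators. -/
inductive Gen
  | x | y | z

/-- The defining relations imposed on the free algebra on the three generators. -/
inductive Rel (n : ℕ) (q : k) : FreeAlgebra k Gen → FreeAlgebra k Gen → Prop
  | x_pow : Rel n q (FreeAlgebra.ι k Gen.x ^ n) 1
  | y_pow : Rel n q (FreeAlgebra.ι k Gen.y ^ n) 1
  | x_y : Rel n q (FreeAlgebra.ι k Gen.x * FreeAlgebra.ι k Gen.y)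
      (FreeAlgebra.ι k Gen.y * FreeAlgebra.ι k Gen.x)
  | z_x : Rel n q (FreeAlgebra.ι k Gen.z * FreeAlgebra.ι k Gen.x)
      (FreeAlgebra.ι k Gen.y * FreeAlgebra.ι k Gen.z)
  | z_y : Rel n q (FreeAlgebra.ι k Gen.z * FreeAlgebra.ι k Gen.y)
      (FreeAlgebra.ι k Gen.x * FreeAlgebra.ι k Gen.z)
  | z_sq : Rel n q (FreeAlgebra.ι k Gen.z ^ 2)
      (twist n q (FreeAlgebra.ι k Gen.x) (FreeAlgebra.ι k Gen.y))

/-- The algebra `H_{2n²}` over `k`, for `n > 1` and a primitive `n`-th root of unity `q`: the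
associative algebra generated by `x, y, z` subject to the defining relations. -/
def H {n : ℕ} {q : k} (_hn : 1 < n) (_hq : IsPrimitiveRoot q n) : Type u :=
  RingQuot (Rel n q)

variable {n : ℕ} {q : k} (hn : 1 < n) (hq : IsPrimitiveRoot q n)

noncomputable instance : Ring (H hn hq) := inferInstanceAs (Ring (RingQuot (Rel n q)))

noncomputable instance : Algebra k (H hn hq) := inferInstanceAs (Algebra k (RingQuot (Rel n q)))

/-- The image of a generator in `H_{2n²}`. -/
noncomputable def gen (g : Gen) : H hn hq := RingQuot.mkAlgHom k (Rel n q) (FreeAlgebra.ι k g)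

theorem gen_relations : Relations n q (gen hn hq .x) (gen hn hq .y) (gen hn hq .z) := by
  have key : ∀ {a b}, Rel n q a b → (RingQuot.mkAlgHom k (Rel n q) a : H hn hq) =
    RingQuot.mkAlgHom k (Rel n q) b := fun h => RingQuot.mkAlgHom_rel k h
  constructor
  · simpa only [map_pow, map_one] using! key .x_pow
  · simpa only [map_pow, map_one] using! key .y_pow
  · simpa only [map_mul] using! key .x_y
  · simpa only [map_mul] using! key .z_x
  · simpa only [map_mul] using! key .z_y
  · simpa only [map_pow, map_twist] using! key .z_sq

variable {hn hq}

/-- The algebra homomorphism out of `H_{2n²}` determined by three elements satisfying the defining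
relations. -/
noncomputable def lift {x y z : A} (h : Relations n q x y z) : H hn hq →ₐ[k] A :=
  RingQuot.liftAlgHom k (s := Rel n q)
    ⟨FreeAlgebra.lift k (fun g => match g with | .x => x | .y => y | .z => z), by
      intro a b hab
      cases hab
      · simpa using h.x_pow
      · simpa using h.y_pow
      · simpa using h.x_y
      · simpa using h.z_x
      · simpa using h.z_y
      · simpa [map_twist] using h.z_sq⟩

@[simp]
theorem lift_x {x y z : A} (h : Relations n q x y z) :
    lift (hn := hn) (hq := hq) h (gen hn hq .x) = x :=
  (RingQuot.liftAlgHom_mkAlgHom_apply k _ _ _).trans (FreeAlgebra.lift_ι_apply _ _)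

@[simp]
theorem lift_y {x y z : A} (h : Relations n q x y z) :
    lift (hn := hn) (hq := hq) h (gen hn hq .y) = y :=
  (RingQuot.liftAlgHom_mkAlgHom_apply k _ _ _).trans (FreeAlgebra.lift_ι_apply _ _)

@[simp]
theorem lift_z {x y z : A} (h : Relations n q x y z) :
    lift (hn := hn) (hq := hq) h (gen hn hq .z) = z :=
  (RingQuot.liftAlgHom_mkAlgHom_apply k _ _ _).trans (FreeAlgebra.lift_ι_apply _ _)

theorem algHom_ext {f g : H hn hq →ₐ[k] A} (hx : f (gen hn hq .x) = g (gen hn hq .x))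
    (hy : f (gen hn hq .y) = g (gen hn hq .y)) (hz : f (gen hn hq .z) = g (gen hn hq .z)) :
    f = g := by
  refine RingQuot.ringQuot_ext' (S := k) (s := Rel n q) f g (FreeAlgebra.hom_ext ?_)
  funext c
  cases c
  · exact hx
  · exact hy
  · exact hz

theorem H_induction {P : H hn hq → Prop} (halg : ∀ c : k, P (algebraMap k _ c))
    (hgen : ∀ g, P (gen hn hq g)) (hadd : ∀ a b, P a → P b → P (a + b))
    (hmul : ∀ a b, P a → P b → P (a * b)) (a : H hn hq) : P a := by
  obtain ⟨w, rfl⟩ := RingQuot.mkAlgHom_surjective k (Rel n q) a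
  induction w using FreeAlgebra.induction with
  | grade0 r => exact (AlgHom.commutes (RingQuot.mkAlgHom k (Rel n q)) r).symm ▸ halg r
  | grade1 g => exact hgen g
  | mul a b ha hb => rw [map_mul]; exact hmul _ _ ha hb
  | add a b ha hb => rw [map_add]; exact hadd _ _ ha hb

end Presentation


section TensorRelations

variable {k : Type u} [Field k] {A B : Type*} [Ring A] [Algebra k A] [Ring B] [Algebra k B]
  {n : ℕ} {q : k}

/-- The element `(1/n) ∑_{i,j} q^{-ij} xⁱz ⊗ yʲz'`. -/
def comulZ (n : ℕ) (q : k) (x z : A) (y' z' : B) : A ⊗[k] B :=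
  (n : k)⁻¹ • ∑ i ∈ Finset.range n, ∑ j ∈ Finset.range n,
    (q⁻¹ ^ (i * j)) • ((x ^ i * z) ⊗ₜ[k] (y' ^ j * z'))

theorem comulZ_eq (n : ℕ) (q : k) (x z : A) (y' z' : B) :
    comulZ n q x z y' z' = twist n q (x ⊗ₜ[k] (1 : B)) ((1 : A) ⊗ₜ[k] y') * (z ⊗ₜ[k] z') := by
  simp only [comulZ, twist, smul_mul_assoc, Finset.sum_mul, Algebra.TensorProduct.tmul_pow,
    Algebra.TensorProduct.tmul_mul_tmul, one_pow, one_mul, mul_one]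

theorem commute_inl_inr (a : A) (b : B) :
    Commute (a ⊗ₜ[k] (1 : B)) ((1 : A) ⊗ₜ[k] b) := by
  simp [Commute, SemiconjBy]

theorem tmul_eq (a : A) (b : B) : a ⊗ₜ[k] b = (a ⊗ₜ[k] (1 : B)) * ((1 : A) ⊗ₜ[k] b) := by
  simp

theorem tensor_relations (hn : 1 < n) (hq : IsPrimitiveRoot q n) {x y z : A} {x' y' z' : B}
    (h : Relations n q x y z) (h' : Relations n q x' y' z') :
    Relations n q (x ⊗ₜ[k] x') (y ⊗ₜ[k] y') (comulZ n q x z y' z') := by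
  have cxy : Commute x y := h.x_y
  have cxy' : Commute x' y' := h'.x_y
  have c1 : ∀ {a b : A}, Commute a b → Commute (a ⊗ₜ[k] (1 : B)) (b ⊗ₜ[k] (1 : B)) := by
    intro a b hab
    simp [Commute, SemiconjBy, hab.eq]
  have c2 : ∀ {a b : B}, Commute a b → Commute ((1 : A) ⊗ₜ[k] a) ((1 : A) ⊗ₜ[k] b) := by
    intro a b hab
    simp [Commute, SemiconjBy, hab.eq]
  have c3 : ∀ {a c : A} {b d : B}, Commute a c → Commute b d →
      Commute (a ⊗ₜ[k] b) (c ⊗ₜ[k] d) := by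
    intro a c b d h1 h2
    simp [Commute, SemiconjBy, h1.eq, h2.eq]
  refine ⟨?_, ?_, ?_, ?_, ?_, ?_⟩
  · simp [Algebra.TensorProduct.tmul_pow, h.x_pow, h'.x_pow, Algebra.TensorProduct.one_def]
  · simp [Algebra.TensorProduct.tmul_pow, h.y_pow, h'.y_pow, Algebra.TensorProduct.one_def]
  · simp [h.x_y, h'.x_y]
  · rw [comulZ_eq, mul_assoc, Algebra.TensorProduct.tmul_mul_tmul, h.z_x, h'.z_x,
      ← Algebra.TensorProduct.tmul_mul_tmul, ← mul_assoc, ← mul_assoc]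
    congr 1
    exact (twist_semiconj (c3 cxy.symm (Commute.one_right _))
      (c3 (Commute.one_right _) (Commute.refl y'))).eq.symm
  · rw [comulZ_eq, mul_assoc, Algebra.TensorProduct.tmul_mul_tmul, h.z_y, h'.z_y,
      ← Algebra.TensorProduct.tmul_mul_tmul, ← mul_assoc, ← mul_assoc]
    congr 1
    exact (twist_semiconj (c3 (Commute.refl x) (Commute.one_right _))
      (c3 (Commute.one_right _) cxy')).eq.symm
  · have hs : SemiconjBy (z ⊗ₜ[k] z') (twist n q (x ⊗ₜ[k] (1 : B)) ((1 : A) ⊗ₜ[k] y'))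
        (twist n q (y ⊗ₜ[k] (1 : B)) ((1 : A) ⊗ₜ[k] x')) := by
      apply twist_semiconj
      · simp [SemiconjBy, h.z_x]
      · simp [SemiconjBy, h'.z_y]
    have hzz : (z ⊗ₜ[k] z') * (z ⊗ₜ[k] z') =
        twist n q (x ⊗ₜ[k] (1 : B)) (y ⊗ₜ[k] (1 : B)) *
          twist n q ((1 : A) ⊗ₜ[k] x') ((1 : A) ⊗ₜ[k] y') := by
      have e1 := map_twist (Algebra.TensorProduct.includeLeft : A →ₐ[k] A ⊗[k] B) n q x y
      have e2 := map_twist (Algebra.TensorProduct.includeRight : B →ₐ[k] A ⊗[k] B) n q x' y'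
      simp only [Algebra.TensorProduct.includeLeft_apply,
        Algebra.TensorProduct.includeRight_apply] at e1 e2
      rw [← e1, ← e2, Algebra.TensorProduct.tmul_mul_tmul, Algebra.TensorProduct.tmul_mul_tmul,
        one_mul, mul_one, ← pow_two, ← pow_two, h.z_sq, h'.z_sq]
    have hx1 : (x ⊗ₜ[k] (1 : B)) ^ n = 1 := by
      simp [Algebra.TensorProduct.tmul_pow, h.x_pow, Algebra.TensorProduct.one_def]
    have hx2 : ((1 : A) ⊗ₜ[k] x') ^ n = 1 := by
      simp [Algebra.TensorProduct.tmul_pow, h'.x_pow, Algebra.TensorProduct.one_def]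
    have hyy : (y ⊗ₜ[k] y') ^ n = 1 := by
      simp [Algebra.TensorProduct.tmul_pow, h.y_pow, h'.y_pow, Algebra.TensorProduct.one_def]
    have key : twist n q (x ⊗ₜ[k] x') (y ⊗ₜ[k] y') =
        (twist n q (x ⊗ₜ[k] (1 : B)) (y ⊗ₜ[k] (1 : B)) *
          twist n q (x ⊗ₜ[k] (1 : B)) ((1 : A) ⊗ₜ[k] y')) *
        (twist n q ((1 : A) ⊗ₜ[k] x') (y ⊗ₜ[k] (1 : B)) *
          twist n q ((1 : A) ⊗ₜ[k] x') ((1 : A) ⊗ₜ[k] y')) := by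
      rw [tmul_eq x x', twist_mul_left hn hq hyy (commute_inl_inr x x')
        (c3 (Commute.one_left _) cxy'), tmul_eq y y',
        twist_mul_right hn hq hx1 (commute_inl_inr y y') (c1 cxy) (commute_inl_inr x y'),
        twist_mul_right hn hq hx2 (commute_inl_inr y y') (commute_inl_inr y x').symm (c2 cxy')]
    have hsw : twist n q ((1 : A) ⊗ₜ[k] x') (y ⊗ₜ[k] (1 : B)) =
        twist n q (y ⊗ₜ[k] (1 : B)) ((1 : A) ⊗ₜ[k] x') :=
      twist_swap (commute_inl_inr y x').symm
    have hc : ∀ {a b c d : A ⊗[k] B}, Commute a c → Commute a d → Commute b c → Commute b d →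
        Commute (twist n q a b) (twist n q c d) := by
      intro a b c d h1 h2 h3 h4
      exact twist_semiconj (twist_semiconj h1.symm h3.symm).symm
        (twist_semiconj h2.symm h4.symm).symm
    have hcomm : Commute (twist n q (x ⊗ₜ[k] (1 : B)) (y ⊗ₜ[k] (1 : B)))
        (twist n q (x ⊗ₜ[k] (1 : B)) ((1 : A) ⊗ₜ[k] y') *
          twist n q (y ⊗ₜ[k] (1 : B)) ((1 : A) ⊗ₜ[k] x')) :=
      (hc (Commute.refl _) (commute_inl_inr _ _) (c1 cxy.symm) (commute_inl_inr _ _)).mul_right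
        (hc (c1 cxy) (commute_inl_inr _ _) (Commute.refl _) (commute_inl_inr _ _))
    rw [key, hsw, comulZ_eq, pow_two, mul_assoc, ← mul_assoc (z ⊗ₜ[k] z'), hs.eq,
      mul_assoc _ (z ⊗ₜ[k] z'), hzz, ← mul_assoc, ← mul_assoc, ← hcomm.eq]
    simp only [mul_assoc]

end TensorRelations

section HopfAlgebra

variable {k : Type u} [Field k] {n : ℕ} {q : k} (hn : 1 < n) (hq : IsPrimitiveRoot q n)

/-- The comultiplication: `Δ(x) = x ⊗ x`, `Δ(y) = y ⊗ y`,
`Δ(z) = (1/n) ∑_{i,j} q^{-ij} xⁱz ⊗ yʲz`. -/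
noncomputable def comul : H hn hq →ₐ[k] H hn hq ⊗[k] H hn hq :=
  lift (x := gen hn hq .x ⊗ₜ[k] gen hn hq .x) (y := gen hn hq .y ⊗ₜ[k] gen hn hq .y)
    (z := comulZ n q (gen hn hq .x) (gen hn hq .z) (gen hn hq .y) (gen hn hq .z))
    (tensor_relations hn hq (gen_relations hn hq) (gen_relations hn hq))

/-- The counit: `ε(x) = ε(y) = ε(z) = 1`. -/
noncomputable def counit : H hn hq →ₐ[k] k :=
  lift (x := 1) (y := 1) (z := 1)
    ⟨one_pow _, one_pow _, rfl, rfl, rfl, by rw [twist_one_left hn hq, one_pow]⟩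

noncomputable instance : Bialgebra k (H hn hq) :=
  Bialgebra.ofAlgHom (comul hn hq) (counit hn hq)
    (by
      have h := gen_relations hn hq
      have cxy : Commute (gen hn hq .x) (gen hn hq .y) := h.x_y
      apply algHom_ext
      · simp [comul]
      · simp [comul]
      · simp only [AlgHom.coe_comp, Function.comp_apply, comul, lift_z]
        set x := gen hn hq .x
        set y := gen hn hq .y
        set z := gen hn hq .z
        simp only [comulZ_eq, map_mul, map_twist, Algebra.TensorProduct.map_tmul, lift_x, lift_y,
          lift_z, map_one, AlgHom.coe_id, id_eq]
        let o : H hn hq := 1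
        have e1 : (Algebra.TensorProduct.assoc k k k (H hn hq) (H hn hq) (H hn hq)).toAlgHom
            ((twist n q (x ⊗ₜ[k] 1) (1 ⊗ₜ[k] y) * z ⊗ₜ[k] z) ⊗ₜ[k] z) =
            twist n q (x ⊗ₜ[k] (o ⊗ₜ[k] o)) (o ⊗ₜ[k] (y ⊗ₜ[k] o)) * z ⊗ₜ[k] (z ⊗ₜ[k] z) := by
          have e0 := map_twist
            ((Algebra.TensorProduct.assoc k k k (H hn hq) (H hn hq) (H hn hq)).toAlgHom.comp
              Algebra.TensorProduct.includeLeft) n q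
              (x ⊗ₜ[k] o) (o ⊗ₜ[k] y)
          simp only [AlgHom.comp_apply, Algebra.TensorProduct.includeLeft_apply] at e0
          have e3 : (twist n q (x ⊗ₜ[k] 1) (1 ⊗ₜ[k] y) * z ⊗ₜ[k] z) ⊗ₜ[k] z =
              (twist n q (x ⊗ₜ[k] 1) (1 ⊗ₜ[k] y) ⊗ₜ[k] 1) * ((z ⊗ₜ[k] z) ⊗ₜ[k] z) := by
            rw [Algebra.TensorProduct.tmul_mul_tmul, one_mul]
          rw [e3, map_mul, e0]
          rfl
        have e2 : z ⊗ₜ[k] (twist n q (x ⊗ₜ[k] o) (o ⊗ₜ[k] y) *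
            z ⊗ₜ[k] z) =
            twist n q (o ⊗ₜ[k] (x ⊗ₜ[k] o)) (o ⊗ₜ[k] (o ⊗ₜ[k] y)) * z ⊗ₜ[k] (z ⊗ₜ[k] z) := by
          have e0 := map_twist
            (Algebra.TensorProduct.includeRight :
              H hn hq ⊗[k] H hn hq →ₐ[k] H hn hq ⊗[k] (H hn hq ⊗[k] H hn hq)) n q
              (x ⊗ₜ[k] o) (o ⊗ₜ[k] y)
          simp only [Algebra.TensorProduct.includeRight_apply] at e0
          rw [← e0, Algebra.TensorProduct.tmul_mul_tmul, one_mul]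
        have hx : x ^ n = 1 := h.x_pow
        have hy : y ^ n = 1 := h.y_pow
        have f1 : twist n q (x ⊗ₜ[k] (x ⊗ₜ[k] o))
              (o ⊗ₜ[k] (o ⊗ₜ[k] y)) =
            twist n q (x ⊗ₜ[k] (o ⊗ₜ[k] o)) (o ⊗ₜ[k] (o ⊗ₜ[k] y)) *
              twist n q (o ⊗ₜ[k] (x ⊗ₜ[k] o)) (o ⊗ₜ[k] (o ⊗ₜ[k] y)) := by
          rw [← twist_mul_left hn hq]
          · simp [o]
          · simp [o, Algebra.TensorProduct.tmul_pow, hy, Algebra.TensorProduct.one_def]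
          · simp [o, Commute, SemiconjBy]
          · simp [o, Commute, SemiconjBy]
        have f2 : twist n q (x ⊗ₜ[k] (1 : H hn hq ⊗[k] H hn hq))
              (o ⊗ₜ[k] (y ⊗ₜ[k] y)) =
            twist n q (x ⊗ₜ[k] (o ⊗ₜ[k] o)) (o ⊗ₜ[k] (y ⊗ₜ[k] o)) *
              twist n q (x ⊗ₜ[k] (o ⊗ₜ[k] o)) (o ⊗ₜ[k] (o ⊗ₜ[k] y)) := by
          rw [← twist_mul_right hn hq]
          · simp [o, Algebra.TensorProduct.one_def]
          · simp [o, Algebra.TensorProduct.tmul_pow, hx, Algebra.TensorProduct.one_def]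
          · simp [o, Commute, SemiconjBy]
          · simp [o, Commute, SemiconjBy]
          · simp [o, Commute, SemiconjBy]
        have hc : ∀ {a b c d : H hn hq ⊗[k] (H hn hq ⊗[k] H hn hq)},
            Commute a c → Commute a d → Commute b c → Commute b d →
            Commute (twist n q a b) (twist n q c d) := by
          intro a b c d h1 h2 h3 h4
          exact twist_semiconj (twist_semiconj h1.symm h3.symm).symm
            (twist_semiconj h2.symm h4.symm).symm
        have g1 : Commute
            (twist n q (o ⊗ₜ[k] (x ⊗ₜ[k] o))
              (o ⊗ₜ[k] (o ⊗ₜ[k] y)))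
            (twist n q (x ⊗ₜ[k] (o ⊗ₜ[k] o))
              (o ⊗ₜ[k] (y ⊗ₜ[k] o))) := by
          apply hc <;> simp [o, Commute, SemiconjBy, cxy.eq]
        have g2 : Commute
            (twist n q (x ⊗ₜ[k] (o ⊗ₜ[k] o))
              (o ⊗ₜ[k] (o ⊗ₜ[k] y)))
            (twist n q (x ⊗ₜ[k] (o ⊗ₜ[k] o))
              (o ⊗ₜ[k] (y ⊗ₜ[k] o))) := by
          apply hc <;> simp [o, Commute, SemiconjBy]
        have f3 : ∀ t t' w : H hn hq ⊗[k] (H hn hq ⊗[k] H hn hq), t = t' → t * w = t' * w :=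
          fun t t' w htt => by rw [htt]
        refine (congrArg₂ (· * ·) (f1 : _ = _) e1).trans ?_
        refine Eq.trans ?_ (congrArg₂ (· * ·) f2 e2).symm
        simp only [← mul_assoc]
        apply f3
        rw [mul_assoc, g1.eq, ← mul_assoc, g2.eq])
    (by
      apply algHom_ext
      · simp [comul, counit]
      · simp [comul, counit]
      · simp only [AlgHom.coe_comp, Function.comp_apply, comul, lift_z, comulZ_eq, map_mul,
          map_twist, Algebra.TensorProduct.map_tmul, counit, lift_x, map_one]
        rw [← Algebra.TensorProduct.one_def, twist_one_left hn hq]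
        simp)
    (by
      apply algHom_ext
      · simp [comul, counit]
      · simp [comul, counit]
      · simp only [AlgHom.coe_comp, Function.comp_apply, comul, lift_z, comulZ_eq, map_mul,
          map_twist, Algebra.TensorProduct.map_tmul, counit, lift_y, map_one]
        rw [← Algebra.TensorProduct.one_def, twist_one_right hn hq]
        simp)


theorem opp_relations : Relations n q (MulOpposite.op (gen hn hq .x ^ (n - 1)))
    (MulOpposite.op (gen hn hq .y ^ (n - 1))) (MulOpposite.op (gen hn hq .z)) := by
  have h := gen_relations hn hq
  set x := gen hn hq .x
  set y := gen hn hq .y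
  set z := gen hn hq .z
  have cxy : Commute x y := h.x_y
  have hx : x ^ (n - 1) * x = 1 := by rw [← pow_succ, Nat.sub_add_cancel (by omega), h.x_pow]
  have hy : y ^ (n - 1) * y = 1 := by rw [← pow_succ, Nat.sub_add_cancel (by omega), h.y_pow]
  have hxn : (x ^ (n - 1)) ^ n = 1 := by rw [← pow_mul, mul_comm, pow_mul, h.x_pow, one_pow]
  have hyn : (y ^ (n - 1)) ^ n = 1 := by rw [← pow_mul, mul_comm, pow_mul, h.y_pow, one_pow]
  refine ⟨?_, ?_, ?_, ?_, ?_, ?_⟩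
  · rw [← MulOpposite.op_pow, hxn, MulOpposite.op_one]
  · rw [← MulOpposite.op_pow, hyn, MulOpposite.op_one]
  · rw [← MulOpposite.op_mul, ← MulOpposite.op_mul, (cxy.pow_pow _ _).eq]
  · rw [← MulOpposite.op_mul, ← MulOpposite.op_mul]
    have : SemiconjBy z y x := h.z_y
    exact congrArg MulOpposite.op (this.pow_right (n - 1)).eq.symm
  · rw [← MulOpposite.op_mul, ← MulOpposite.op_mul]
    have : SemiconjBy z x y := h.z_x
    exact congrArg MulOpposite.op (this.pow_right (n - 1)).eq.symm
  · have e1 : twist n q (MulOpposite.op (x ^ (n - 1))) (MulOpposite.op (y ^ (n - 1))) =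
        MulOpposite.op (twist n q (x ^ (n - 1)) (y ^ (n - 1))) := by
      simp only [twist, MulOpposite.op_smul, Finset.op_sum, MulOpposite.op_mul, MulOpposite.op_pow]
      congr 1
      refine Finset.sum_congr rfl fun i _ => Finset.sum_congr rfl fun j _ => ?_
      congr 1
      simp only [← MulOpposite.op_pow, ← MulOpposite.op_mul]
      congr 1
      exact (((cxy.pow_pow (n - 1) (n - 1)).pow_pow i j).eq).symm
    have e2 : twist n q (x ^ (n - 1)) (y ^ (n - 1)) * twist n q x (y ^ (n - 1)) = 1 := by
      rw [← twist_mul_left hn hq hyn ((Commute.refl x).pow_left _) (cxy.pow_right _), hx,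
        twist_one_left hn hq]
    have e3 : twist n q x (y ^ (n - 1)) * twist n q x y = 1 := by
      rw [← twist_mul_right hn hq h.x_pow ((Commute.refl y).pow_left _) (cxy.pow_right _) cxy, hy,
        twist_one_right hn hq]
    rw [e1, left_inv_eq_right_inv e2 e3, ← h.z_sq, MulOpposite.op_pow]

/-- The antipode as a homomorphism to the opposite algebra: `S(x) = x⁻¹`, `S(y) = y⁻¹`,
`S(z) = z`, where `x⁻¹ = xⁿ⁻¹` and `y⁻¹ = yⁿ⁻¹`. -/
noncomputable def antipodeOp : H hn hq →ₐ[k] (H hn hq)ᵐᵒᵖ := lift (opp_relations hn hq)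

/-- The antipode. -/
noncomputable def antipode : H hn hq →ₗ[k] H hn hq :=
  (MulOpposite.opLinearEquiv k).symm.toLinearMap ∘ₗ (antipodeOp hn hq).toLinearMap

theorem antipode_mul (a b : H hn hq) :
    antipode hn hq (a * b) = antipode hn hq b * antipode hn hq a := by
  simp [antipode]

theorem antipode_algebraMap (c : k) :
    antipode hn hq (algebraMap k _ c) = algebraMap k _ c := by
  simp [antipode, MulOpposite.algebraMap_apply]

theorem antipode_one : antipode hn hq 1 = 1 := by
  simp [antipode]

theorem antipode_pow (a : H hn hq) (i : ℕ) : antipode hn hq (a ^ i) = antipode hn hq a ^ i := by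
  simp [antipode]

theorem antipode_x : antipode hn hq (gen hn hq .x) = gen hn hq .x ^ (n - 1) := by
  simp [antipode, antipodeOp]

theorem antipode_y : antipode hn hq (gen hn hq .y) = gen hn hq .y ^ (n - 1) := by
  simp [antipode, antipodeOp]

theorem antipode_z : antipode hn hq (gen hn hq .z) = gen hn hq .z := by
  simp [antipode, antipodeOp]

theorem comul_x : Coalgebra.comul (R := k) (gen hn hq .x) = gen hn hq .x ⊗ₜ[k] gen hn hq .x :=
  lift_x _

theorem comul_y : Coalgebra.comul (R := k) (gen hn hq .y) = gen hn hq .y ⊗ₜ[k] gen hn hq .y :=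
  lift_y _

theorem comul_z : Coalgebra.comul (R := k) (gen hn hq .z) =
    comulZ n q (gen hn hq .x) (gen hn hq .z) (gen hn hq .y) (gen hn hq .z) :=
  lift_z _

theorem counit_gen (g : Gen) : Coalgebra.counit (R := k) (gen hn hq g) = 1 := by
  cases g
  · exact lift_x _
  · exact lift_y _
  · exact lift_z _

theorem twist_mul_inv : twist n q (gen hn hq .x) (gen hn hq .y ^ (n - 1)) *
    twist n q (gen hn hq .x) (gen hn hq .y) = 1 := by
  have h := gen_relations hn hq
  have cxy : Commute (gen hn hq .x) (gen hn hq .y) := h.x_y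
  rw [← twist_mul_right hn hq h.x_pow ((Commute.refl _).pow_left _) (cxy.pow_right _) cxy,
    ← pow_succ, Nat.sub_add_cancel hn.le, h.y_pow, twist_one_right hn hq]

theorem antipode_left (a : H hn hq) :
    LinearMap.mul' k (H hn hq) ((antipode hn hq).rTensor (H hn hq) (Coalgebra.comul a)) =
      algebraMap k _ (Coalgebra.counit (R := k) a) := by
  have h := gen_relations hn hq
  induction a using H_induction with
  | halg c =>
    rw [Bialgebra.comul_algebraMap, Bialgebra.counit_algebraMap,
      Algebra.TensorProduct.algebraMap_apply]
    simp [antipode_algebraMap]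
  | hgen g =>
    rw [counit_gen, map_one]
    cases g with
    | x => simp [comul_x, antipode_x, ← pow_succ, Nat.sub_add_cancel hn.le, h.x_pow]
    | y => simp [comul_y, antipode_y, ← pow_succ, Nat.sub_add_cancel hn.le, h.y_pow]
    | z =>
      have cxy : Commute (gen hn hq .x) (gen hn hq .y) := h.x_y
      have e1 : LinearMap.mul' k (H hn hq) ((antipode hn hq).rTensor (H hn hq)
          (Coalgebra.comul (gen hn hq .z))) =
          gen hn hq .z * twist n q (gen hn hq .x ^ (n - 1)) (gen hn hq .y) * gen hn hq .z := by
        rw [comul_z]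
        simp [comulZ, twist, Finset.mul_sum, Finset.sum_mul, antipode_mul, antipode_pow,
          antipode_x, antipode_z, mul_assoc]
      have hs : SemiconjBy (gen hn hq .z) (twist n q (gen hn hq .x ^ (n - 1)) (gen hn hq .y))
          (twist n q (gen hn hq .y ^ (n - 1)) (gen hn hq .x)) :=
        twist_semiconj (SemiconjBy.pow_right h.z_x _) h.z_y
      rw [e1, hs.eq, mul_assoc, ← pow_two, h.z_sq, twist_swap (cxy.symm.pow_left _),
        twist_mul_inv hn hq]
  | hadd a b ha hb => simp only [map_add, ha, hb]
  | hmul a b ha hb =>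
    have key : ∀ u w : H hn hq ⊗[k] H hn hq, ∀ c : k,
        LinearMap.mul' k (H hn hq) ((antipode hn hq).rTensor (H hn hq) u) = algebraMap k _ c →
        LinearMap.mul' k (H hn hq) ((antipode hn hq).rTensor (H hn hq) (u * w)) =
          c • LinearMap.mul' k (H hn hq) ((antipode hn hq).rTensor (H hn hq) w) := by
      intro u w c hu
      induction w with
      | zero => simp
      | add w w' hw hw' => simp only [mul_add, map_add, hw, hw', smul_add]
      | tmul s t =>
        have : ∀ u : H hn hq ⊗[k] H hn hq,
            LinearMap.mul' k (H hn hq) ((antipode hn hq).rTensor (H hn hq) (u * s ⊗ₜ[k] t)) =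
              antipode hn hq s *
                LinearMap.mul' k (H hn hq) ((antipode hn hq).rTensor (H hn hq) u) * t := by
          intro u
          induction u with
          | zero => simp
          | add u u' hu hu' => simp only [add_mul, mul_add, map_add, hu, hu']
          | tmul a b => simp [antipode_mul, mul_assoc]
        rw [this, hu, ← Algebra.commutes]
        simp [Algebra.smul_def, mul_assoc]
    rw [Bialgebra.comul_mul, Bialgebra.counit_mul, key _ _ _ ha, hb, map_mul, Algebra.smul_def]

theorem antipode_right (a : H hn hq) :
    LinearMap.mul' k (H hn hq) ((antipode hn hq).lTensor (H hn hq) (Coalgebra.comul a)) =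
      algebraMap k _ (Coalgebra.counit (R := k) a) := by
  have h := gen_relations hn hq
  induction a using H_induction with
  | halg c =>
    rw [Bialgebra.comul_algebraMap, Bialgebra.counit_algebraMap,
      Algebra.TensorProduct.algebraMap_apply]
    simp [antipode_one]
  | hgen g =>
    rw [counit_gen, map_one]
    cases g with
    | x => simp [comul_x, antipode_x, ← pow_succ', Nat.sub_add_cancel hn.le, h.x_pow]
    | y => simp [comul_y, antipode_y, ← pow_succ', Nat.sub_add_cancel hn.le, h.y_pow]
    | z =>
      have e1 : LinearMap.mul' k (H hn hq) ((antipode hn hq).lTensor (H hn hq)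
          (Coalgebra.comul (gen hn hq .z))) =
          twist n q (gen hn hq .x) (gen hn hq .y ^ (n - 1)) * gen hn hq .z ^ 2 := by
        have s1 : SemiconjBy (gen hn hq .z) (gen hn hq .y ^ (n - 1)) (gen hn hq .x ^ (n - 1)) :=
          SemiconjBy.pow_right h.z_y _
        have s2 : SemiconjBy (gen hn hq .z) (gen hn hq .x ^ (n - 1)) (gen hn hq .y ^ (n - 1)) :=
          SemiconjBy.pow_right h.z_x _
        have s3 : Commute (gen hn hq .z ^ 2) (gen hn hq .y ^ (n - 1)) := by
          rw [pow_two]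
          exact s2.mul_left s1
        have s4 : ∀ j : ℕ, gen hn hq .z * (gen hn hq .z * (gen hn hq .y ^ (n - 1)) ^ j) =
            (gen hn hq .y ^ (n - 1)) ^ j * gen hn hq .z ^ 2 := by
          intro j
          rw [← mul_assoc, ← pow_two, (s3.pow_right j).eq]
        rw [comul_z]
        simp only [comulZ, twist, Finset.sum_mul, antipode_mul, antipode_pow, map_smul, map_sum,
          antipode_y, antipode_z, mul_assoc, LinearMap.lTensor_tmul, LinearMap.mul'_apply,
          smul_mul_assoc, s4]
      rw [e1, h.z_sq, twist_mul_inv hn hq]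
  | hadd a b ha hb => simp only [map_add, ha, hb]
  | hmul a b ha hb =>
    have key : ∀ u w : H hn hq ⊗[k] H hn hq, ∀ c : k,
        LinearMap.mul' k (H hn hq) ((antipode hn hq).lTensor (H hn hq) w) = algebraMap k _ c →
        LinearMap.mul' k (H hn hq) ((antipode hn hq).lTensor (H hn hq) (u * w)) =
          c • LinearMap.mul' k (H hn hq) ((antipode hn hq).lTensor (H hn hq) u) := by
      intro u w c hw
      induction u with
      | zero => simp
      | add u u' hu hu' => simp only [add_mul, map_add, hu, hu', smul_add]
      | tmul s t =>
        have : ∀ w : H hn hq ⊗[k] H hn hq,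
            LinearMap.mul' k (H hn hq) ((antipode hn hq).lTensor (H hn hq) (s ⊗ₜ[k] t * w)) =
              s * LinearMap.mul' k (H hn hq) ((antipode hn hq).lTensor (H hn hq) w) *
                antipode hn hq t := by
          intro w
          induction w with
          | zero => simp
          | add w w' hw hw' => simp only [add_mul, mul_add, map_add, hw, hw']
          | tmul a b => simp [antipode_mul, mul_assoc]
        rw [this, hw, ← Algebra.commutes]
        simp [Algebra.smul_def, mul_assoc]
    rw [Bialgebra.comul_mul, Bialgebra.counit_mul, key _ _ _ hb, ha, map_mul, Algebra.smul_def,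
      Algebra.commutes]

noncomputable instance : HopfAlgebra k (H hn hq) where
  antipode := antipode hn hq
  mul_antipode_rTensor_comul := LinearMap.ext (antipode_left hn hq)
  mul_antipode_lTensor_comul := LinearMap.ext (antipode_right hn hq)

end HopfAlgebra

section Modules

open HopfRep Matrix

variable {k : Type u} [Field k] {n : ℕ} {q : k}

/-- The sign `σ(m)` for `m` modulo `2n`: `1` on `0, …, n-1` and `-1` on `n, …, 2n-1`. -/
def sign (n m : ℕ) : ℤ := if m % (2 * n) < n then 1 else -1

/-- The square root `q^{1/2} = q^{(n+1)/2}` of `q`, for odd `n`. -/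
def halfRoot (n : ℕ) (q : k) : k := q ^ ((n + 1) / 2)

theorem halfRoot_sq (hq : IsPrimitiveRoot q n) (hodd : Odd n) : halfRoot n q ^ 2 = q := by
  obtain ⟨r, rfl⟩ := hodd
  rw [halfRoot, ← pow_mul, show (2 * r + 1 + 1) / 2 * 2 = (2 * r + 1) + 1 by omega, pow_succ,
    hq.pow_eq_one, one_mul]

theorem sign_sq (n m : ℕ) : ((sign n m : ℤ) : k) ^ 2 = 1 := by
  unfold sign
  split_ifs <;> simp

theorem one_dim_relations (hn : 1 < n) (hq : IsPrimitiveRoot q n) (hodd : Odd n) (m : ℕ) :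
    Relations n q (q ^ m) (q ^ m) ((sign n m : k) * halfRoot n q ^ (m ^ 2)) := by
  have hp : (q ^ m) ^ n = 1 := by rw [← pow_mul, mul_comm, pow_mul, hq.pow_eq_one, one_pow]
  refine ⟨hp, hp, rfl, mul_comm _ _, mul_comm _ _, ?_⟩
  rw [mul_pow, sign_sq, one_mul, ← pow_mul, mul_comm, pow_mul, halfRoot_sq hq hodd,
    twist_pow_pow hn hq, pow_two]

/-- The one-dimensional module `S_m`, `m ∈ ℤ/2n`, for odd `n`: on the vector space `k`, `x` and `y`
act as `q^m` and `z` as `σ(m) q^{m²/2}`. -/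
noncomputable def S (hn : 1 < n) (hq : IsPrimitiveRoot q n) (hodd : Odd n) (m : ℕ) : FDMod k (H hn hq) where
  V := k
  act := (Algebra.ofId k (Module.End k k)).comp (lift (one_dim_relations hn hq hodd m))

theorem two_dim_relations (hn : 1 < n) (hq : IsPrimitiveRoot q n) (i j : ℕ) :
    Relations n q (diagonal ![q ^ i, q ^ j]) (diagonal ![q ^ j, q ^ i])
      !![0, q ^ (i * j); 1, 0] := by
  have hp : ∀ m : ℕ, (q ^ m) ^ n = 1 := fun m => by
    rw [← pow_mul, mul_comm, pow_mul, hq.pow_eq_one, one_pow]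
  have hd : ∀ a b : ℕ, (diagonal ![q ^ a, q ^ b] : Matrix (Fin 2) (Fin 2) k) ^ n = 1 := by
    intro a b
    rw [diagonal_pow, ← diagonal_one]
    congr 1
    ext c
    fin_cases c <;> simp [hp]
  refine ⟨hd i j, hd j i, ?_, ?_, ?_, ?_⟩
  · rw [diagonal_mul_diagonal, diagonal_mul_diagonal]
    congr 1
    ext c
    exact mul_comm _ _
  · ext a b
    fin_cases a <;> fin_cases b <;> simp [mul_comm]
  · ext a b
    fin_cases a <;> fin_cases b <;> simp [mul_comm]
  · have e1 := map_twist (diagonalAlgHom k : (Fin 2 → k) →ₐ[k] Matrix (Fin 2) (Fin 2) k) n q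
      ![q ^ i, q ^ j] ![q ^ j, q ^ i]
    simp only [diagonalAlgHom_apply] at e1
    have e2 : twist n q ![q ^ i, q ^ j] ![q ^ j, q ^ i] = fun _ => q ^ (i * j) := by
      ext c
      have e3 := map_twist (Pi.evalAlgHom k (fun _ : Fin 2 => k) c) n q
        ![q ^ i, q ^ j] ![q ^ j, q ^ i]
      simp only [Pi.evalAlgHom_apply] at e3
      rw [e3]
      fin_cases c
      · simpa using twist_pow_pow hn hq i j
      · simpa [mul_comm] using twist_pow_pow hn hq j i
    rw [← e1, e2]
    ext a b
    fin_cases a <;> fin_cases b <;> simp [pow_two]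

/-- The two-dimensional module `S_{i,j}` (for `0 ≤ i < j ≤ n - 1`): on column vectors in `k²`, `x`
acts as the matrix `diag(q^i, q^j)`, `y` as `diag(q^j, q^i)` and `z` as `(0, q^{ij}; 1, 0)`. -/
noncomputable def S₂ (hn : 1 < n) (hq : IsPrimitiveRoot q n) (i j : ℕ) : FDMod k (H hn hq) where
  V := Fin 2 → k
  act := (toLinAlgEquiv' : Matrix (Fin 2) (Fin 2) k ≃ₐ[k] _).toAlgHom.comp
    (lift (two_dim_relations hn hq i j))

end Modules

/-! ## The relations -/

section Polynomials

open MvPolynomial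

/-- The variable `y` of `ℤ[y, z]`. -/
noncomputable def y : MvPolynomial (Fin 2) ℤ := X 0

/-- The variable `z` of `ℤ[y, z]`. -/
noncomputable def z : MvPolynomial (Fin 2) ℤ := X 1

/-- The generalized Fibonacci polynomials: `F₀ = 0`, `F₁ = 1`, `F_{t+2} = z F_{t+1} - y F_t`. -/
noncomputable def fib : ℕ → MvPolynomial (Fin 2) ℤ
  | 0 => 0
  | 1 => 1
  | t + 2 => z * fib (t + 1) - y * fib t

/-- The relation of degree `m + 1` in `z`, for `m ≥ 1`. -/
noncomputable def thirdRel (n m : ℕ) : MvPolynomial (Fin 2) ℤ :=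
  z ^ (m + 1) - z ^ m * y ^ (m + 1)
    + ∑ i ∈ Finset.Icc 1 ((m + 1) / 2),
        (-1) ^ i * ((m + 1 - i).choose i : MvPolynomial (Fin 2) ℤ) * y ^ i * z ^ (m + 1 - 2 * i)
    - ∑ i ∈ Finset.Icc 1 (m / 2),
        (-1) ^ i * ((m - i).choose i : MvPolynomial (Fin 2) ℤ) * y ^ (m + 1 + i) * z ^ (m - 2 * i)
    - y ^ (n + 1) * fib m + y ^ (m + n + 2) * fib (m - 1)

/-- The ideal of `ℤ[y, z]` generated by the three relations, where `m = (n - 1) / 2`. -/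
noncomputable def relIdeal (n : ℕ) : Ideal (MvPolynomial (Fin 2) ℤ) :=
  Ideal.span {y ^ (2 * n) - 1, z * y ^ n - z, thirdRel n ((n - 1) / 2)}

end Polynomials

end HTwoNSq

/-! The commuting elements `x` and `y` are diagonalizable on every module. Call a joint eigenvector
with eigenvalues q^i, q^j a vector of weight (i, j). On it z² is the scalar q^{ij}, and `z`
exchanges the weights (i, j) and (j, i). So a vector of weight (i, j) with i ≢ j mod n generates a
copy of `S₂ i j`, while weight (i, i) yields an eigenvector of `z` with eigenvalue ±q^{i²/2}. The
resulting lines are indexed as `lineMod t`, with `z` acting by (-1)^t q^{t²/2}: as n is odd, t mod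
2n records both the weight mod n and the sign. In this indexing `lineMod` is additive under tensor
products, and S_{n+1} is `lineMod 1`.

The product rule [S₂ i j][S₂ a b] = [S₂ (i+a) (j+b)] + [S₂ (i+b) (j+a)] turns into a Lucas
recursion: the polynomial y^i L_s (`lucas`) maps to [S₂ i (i+s)] (`map_y_pow_mul_lucas`), where L₀ =
1 + yⁿ reflects [S₂ 0 0] = 1 + [lineMod n]. The third relation is L_{m+1} - y^{m+1} L_m in disguise
(`thirdRel_eq`). It holds because S₂ 0 (m+1) ≅ S₂ (m+1) 0 and 0 ≡ (m+1) + m mod n. The other two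
relations are periodicity of the weights and signs.

Surjectivity: every nonzero module contains some `lineMod t` or `S₂ i j` (`exists_injective_hom`),
so induction on dimension applies. Injectivity: the quotient ring is additively spanned by the y^t
with t mod 2n and the y^i L_s with i mod n and 1 ≤ s ≤ m (`map_mem_of_basis_mem`). For an idempotent
e, M ↦ dim eM is additive on short exact sequences (`FDMod.rk_shortExact`). Suitable idempotents
detect each spanning class exactly once, and so give an additive left inverse
(`exists_leftInverse`). Neither semisimplicity nor the classification of simple modules up to
isomorphism is needed. -/

namespace HopfRep

universe u v

/-! ### Exact sequences of modules and ranks of idempotents -/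

section Quotient

variable {k : Type u} {H : Type v} [Field k] [Ring H] [Algebra k H]

theorem FDMod.exists_shortExact_of_injective {N M : FDMod k H} (f : N.V →ₗ[k] M.V)
    (hf : N.IsHom M f) (hinj : Function.Injective f) :
    ∃ Q : FDMod k H, FDMod.ShortExact N M Q ∧
      Module.finrank k N.V + Module.finrank k Q.V = Module.finrank k M.V := by
  have hle : ∀ h : H, LinearMap.range f ≤ (LinearMap.range f).comap (M.act h) := by
    rintro h _ ⟨v, rfl⟩
    exact ⟨N.act h v, hf h v⟩
  let act : H →ₐ[k] Module.End k (M.V ⧸ LinearMap.range f) :=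
    { toFun := fun h => (LinearMap.range f).mapQ (LinearMap.range f) (M.act h) (hle h)
      map_one' := by ext v; simp
      map_mul' := fun a b => by ext v; simp
      map_zero' := by ext v; simp
      map_add' := fun a b => by ext v; simp
      commutes' := fun c => by ext v; simp [Module.algebraMap_end_apply] }
  refine ⟨{ V := M.V ⧸ LinearMap.range f, act := act },
    ⟨f, (LinearMap.range f).mkQ, hf, fun _ _ => rfl, hinj, Submodule.mkQ_surjective _, ?_⟩, ?_⟩
  · rw [LinearMap.exact_iff]
    exact Submodule.ker_mkQ _
  · have h1 := (LinearMap.range f).finrank_quotient_add_finrank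
    rw [LinearMap.finrank_range_of_inj hinj] at h1
    rw [add_comm]
    exact h1

/-- The direct sum of two modules. -/
def FDMod.prod (M N : FDMod k H) : FDMod k H where
  V := M.V × N.V
  act :=
    { toFun := fun h => (M.act h).prodMap (N.act h)
      map_one' := by ext <;> simp
      map_mul' := fun a b => by ext <;> simp
      map_zero' := by ext <;> simp
      map_add' := fun a b => by ext <;> simp
      commutes' := fun c => by ext <;> simp [Module.algebraMap_end_apply] }

theorem FDMod.shortExact_prod (M N : FDMod k H) : FDMod.ShortExact M (M.prod N) N :=
  ⟨LinearMap.inl k M.V N.V, LinearMap.snd k M.V N.V,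
    fun h _ => Prod.ext rfl (map_zero (N.act h)).symm, fun _ _ => rfl, LinearMap.inl_injective,
    LinearMap.snd_surjective, Function.Exact.inl_snd⟩

theorem FDMod.iso_of_surjective {M N : FDMod k H} (f : M.V →ₗ[k] N.V) (hf : M.IsHom N f)
    (hs : Function.Surjective f) (hd : Module.finrank k M.V = Module.finrank k N.V) : M.Iso N :=
  ⟨LinearEquiv.ofBijective f ⟨(LinearMap.injective_iff_surjective_of_finrank_eq_finrank hd).2 hs,
    hs⟩, hf⟩

/-- The dimension of `eM`. -/
noncomputable def FDMod.rk (e : H) (M : FDMod k H) : ℕ := Module.finrank k (LinearMap.range (M.act e))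

/-- For an idempotent e the functor M ↦ eM is exact: `g` restricts to a surjection eY → eZ with
kernel f(eX), and rank-nullity gives the count. -/
theorem FDMod.rk_shortExact {e : H} (he : e * e = e) {X Y Z : FDMod k H}
    (h : FDMod.ShortExact X Y Z) : Y.rk e = X.rk e + Z.rk e := by
  obtain ⟨f, g, hf, hg, hinj, hsurj, hex⟩ := h
  have hfix : ∀ (M : FDMod k H) (v : M.V), M.act e (M.act e v) = M.act e v := fun M v => by
    rw [← Module.End.mul_apply, ← map_mul, he]
  have h1 := LinearMap.finrank_range_add_finrank_ker (g.domRestrict (LinearMap.range (Y.act e)))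
  have h2 : LinearMap.range (g.domRestrict (LinearMap.range (Y.act e))) =
      LinearMap.range (Z.act e) := by
    ext z
    constructor
    · rintro ⟨⟨_, y, rfl⟩, rfl⟩
      exact ⟨g y, (hg e y).symm⟩
    · rintro ⟨z, rfl⟩
      obtain ⟨y, rfl⟩ := hsurj z
      exact ⟨⟨_, y, rfl⟩, hg e y⟩
  have h3 : (LinearMap.ker (g.domRestrict (LinearMap.range (Y.act e)))).map
      (LinearMap.range (Y.act e)).subtype = (LinearMap.range (X.act e)).map f := by
    ext y
    constructor
    · rintro ⟨⟨_, y, rfl⟩, hy, rfl⟩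
      obtain ⟨x, hx⟩ := (hex _).1 hy
      -- A preimage x of a vector of eY may be replaced by ex, since e fixes that vector.
      refine ⟨X.act e x, ⟨x, rfl⟩, ?_⟩
      rw [hf, hx]
      exact hfix Y y
    · rintro ⟨_, ⟨x, rfl⟩, rfl⟩
      exact ⟨⟨f (X.act e x), f x, (hf e x).symm⟩, (hex _).2 ⟨_, rfl⟩, rfl⟩
  have h4 := LinearEquiv.finrank_eq (Submodule.equivMapOfInjective f hinj (LinearMap.range (X.act e)))
  have h5 := LinearEquiv.finrank_eq (Submodule.equivMapOfInjective _
    (LinearMap.range (Y.act e)).injective_subtype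
      (LinearMap.ker (g.domRestrict (LinearMap.range (Y.act e)))))
  rw [h3] at h5
  rw [h2] at h1
  unfold FDMod.rk
  omega

end Quotient

/-! ### The Grothendieck ring and its additive universal property -/

section Grothendieck

variable {k : Type u} {H : Type v} [Field k] [Ring H] [Bialgebra k H]

theorem FDMod.isHom_tensor_map {M M' N N' : FDMod k H} {f : M.V →ₗ[k] M'.V} {g : N.V →ₗ[k] N'.V}
    (hf : M.IsHom M' f) (hg : N.IsHom N' g) :
    (M.tensor N).IsHom (M'.tensor N') (TensorProduct.map f g) := by
  intro h v
  change TensorProduct.map f g (extAct M.act N.act (Coalgebra.comul h) v) =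
    extAct M'.act N'.act (Coalgebra.comul h) (TensorProduct.map f g v)
  generalize (Coalgebra.comul h : H ⊗[k] H) = w
  change M.V ⊗[k] N.V at v
  induction w with
  | zero => simp
  | add a b ha hb => simp only [map_add, LinearMap.add_apply, ha, hb]
  | tmul a b =>
    induction v with
    | zero => simp
    | add x y hx hy => simp only [map_add, hx, hy]
    | tmul x y => simp [hf a x, hg b y]

theorem FDMod.isHom_id (M : FDMod k H) : M.IsHom M LinearMap.id := fun _ _ => rfl

theorem FDMod.ShortExact.tensor_left {X Y Z : FDMod k H} (h : FDMod.ShortExact X Y Z)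
    (M : FDMod k H) : FDMod.ShortExact (M.tensor X) (M.tensor Y) (M.tensor Z) := by
  obtain ⟨f, g, hf, hg, hinj, hsurj, hex⟩ := h
  exact ⟨LinearMap.lTensor M.V f, LinearMap.lTensor M.V g, isHom_tensor_map M.isHom_id hf,
    isHom_tensor_map M.isHom_id hg, Module.Flat.lTensor_preserves_injective_linearMap f hinj,
    LinearMap.lTensor_surjective M.V hsurj, lTensor_exact M.V hex hsurj⟩

theorem FDMod.ShortExact.tensor_right {X Y Z : FDMod k H} (h : FDMod.ShortExact X Y Z)
    (M : FDMod k H) : FDMod.ShortExact (X.tensor M) (Y.tensor M) (Z.tensor M) := by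
  obtain ⟨f, g, hf, hg, hinj, hsurj, hex⟩ := h
  exact ⟨LinearMap.rTensor M.V f, LinearMap.rTensor M.V g, isHom_tensor_map hf M.isHom_id,
    isHom_tensor_map hg M.isHom_id, Module.Flat.rTensor_preserves_injective_linearMap f hinj,
    LinearMap.rTensor_surjective M.V hsurj, rTensor_exact M.V hex hsurj⟩

theorem cls_eq_of_iso {M N : FDMod k H} (h : M.Iso N) : cls M = cls N :=
  congrArg (fun c => RingQuot.mkRingHom (GrothendieckRel k H) (FreeAbelianGroup.of c))
    (Quotient.sound h)

theorem cls_of_shortExact {X Y Z : FDMod k H} (h : FDMod.ShortExact X Y Z) :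
    cls Y = cls X + cls Z :=
  (RingQuot.mkRingHom_rel (GrothendieckRel.ses X Y Z h)).trans (map_add _ _ _)

theorem freeClass_tensor (M N : FDMod k H) :
    freeClass (M.tensor N) = freeClass M * freeClass N :=
  FreeAbelianGroup.of_mul (α := IsoClass k H) (Quotient.mk _ M) (Quotient.mk _ N)

theorem cls_tensor (M N : FDMod k H) : cls (M.tensor N) = cls M * cls N :=
  (congrArg (RingQuot.mkRingHom (GrothendieckRel k H)) (freeClass_tensor M N)).trans (map_mul _ _ _)

theorem cls_triv : cls (FDMod.triv k H) = 1 :=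
  map_one (RingQuot.mkRingHom (GrothendieckRel k H))

theorem cls_prod (M N : FDMod k H) : cls (M.prod N) = cls M + cls N :=
  cls_of_shortExact (M.shortExact_prod N)

theorem FDMod.shortExact_self_of_finrank_eq_zero {M : FDMod k H} (hM : Module.finrank k M.V = 0) :
    FDMod.ShortExact M M M := by
  have := Module.finrank_zero_iff.1 hM
  exact ⟨LinearMap.id, LinearMap.id, M.isHom_id, M.isHom_id, Function.injective_id,
    Function.surjective_id, fun v => ⟨fun _ => ⟨v, rfl⟩, fun _ => Subsingleton.elim _ _⟩⟩

theorem cls_eq_zero {M : FDMod k H} (hM : Module.finrank k M.V = 0) : cls M = 0 := by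
  have := cls_of_shortExact (FDMod.shortExact_self_of_finrank_eq_zero hM)
  exact left_eq_add.1 this

theorem GrothendieckRing.induction {P : GrothendieckRing k H → Prop} (hcls : ∀ M, P (cls M))
    (hneg : ∀ a, P a → P (-a)) (hadd : ∀ a b, P a → P b → P (a + b)) (hzero : P 0)
    (a : GrothendieckRing k H) : P a := by
  obtain ⟨w, rfl⟩ := RingQuot.mkRingHom_surjective (GrothendieckRel k H) a
  induction w using FreeAbelianGroup.induction_on with
  | zero => rw [map_zero]; exact hzero
  | of c => obtain ⟨M⟩ := c; exact hcls M
  | neg c h => rw [map_neg]; exact hneg _ h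
  | add a b ha hb => rw [map_add]; exact hadd _ _ ha hb

/-- The Grothendieck ring is a ring quotient, so a priori it divides out the two-sided ideal
generated by the exact-sequence relations. Tensoring over a field preserves exactness on both sides,
so that ideal is already the additive span of the relations, and an additive function descends
without being multiplicative. -/
theorem exists_addMonoidHom_of_additive {A : Type*} [AddCommGroup A] (f : FDMod k H → A)
    (hf : ∀ X Y Z, FDMod.ShortExact X Y Z → f Y = f X + f Z) :
    ∃ F : GrothendieckRing k H →+ A, ∀ M, F (cls M) = f M := by
  -- Invariance under isomorphism follows from additivity: an isomorphism is an injection with zero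
  -- cokernel Q, and `f Q = f Q + f Q` forces `f Q = 0`.
  have hiso : ∀ M N : FDMod k H, M.Iso N → f M = f N := by
    rintro M N ⟨e, he⟩
    obtain ⟨Q, hQ, hd⟩ := FDMod.exists_shortExact_of_injective e.toLinearMap he e.injective
    have h0 : Module.finrank k Q.V = 0 := by
      have := e.finrank_eq
      omega
    have h1 := hf _ _ _ (FDMod.shortExact_self_of_finrank_eq_zero h0)
    rw [hf _ _ _ hQ, left_eq_add.1 h1, add_zero]
  let f' : FreeAbelianGroup (IsoClass k H) →+ A := FreeAbelianGroup.lift (Quotient.lift f hiso)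
  have hf' : ∀ M, f' (freeClass M) = f M := fun M => FreeAbelianGroup.lift_apply_of _ _
  -- The factors c and d on both sides make the induction pass through the multiplicative closure
  -- steps of `RingQuot.Rel`.
  have hrel : ∀ a b, RingQuot.Rel (GrothendieckRel k H) a b → ∀ c d, f' (c * a * d) = f' (c * b * d) := by
    intro a b hab
    induction hab with
    | of hab =>
      obtain ⟨X, Y, Z, h⟩ := hab
      intro c d
      induction c using FreeAbelianGroup.induction_on with
      | zero => simp
      | neg c hc => simp only [neg_mul, map_neg, hc]
      | add a b ha hb => simp only [add_mul, map_add] at ha hb ⊢; rw [ha, hb]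
      | of c =>
        obtain ⟨M⟩ := c
        induction d using FreeAbelianGroup.induction_on with
        | zero => simp
        | neg c hc => simp only [mul_neg, map_neg, hc]
        | add a b ha hb => simp only [mul_add, map_add] at ha hb ⊢; rw [ha, hb]
        | of d =>
          obtain ⟨N⟩ := d
          change f' (freeClass M * _ * freeClass N) = f' (freeClass M * _ * freeClass N)
          rw [mul_add, add_mul, map_add]
          simp only [← freeClass_tensor, hf']
          exact hf _ _ _ ((h.tensor_left M).tensor_right N)
    | add_left _ ih =>
      intro c d
      simp only [mul_add, add_mul, map_add, ih]
    | mul_left _ ih =>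
      intro c d
      rw [← mul_assoc c, ← mul_assoc c, mul_assoc _ _ d, mul_assoc _ _ d, ih]
    | mul_right _ ih =>
      intro c d
      rw [← mul_assoc c, ← mul_assoc c, ih]
  let F : RingQuot (GrothendieckRel k H) → A := fun x => Quot.lift f' (fun a b hab => by
    simpa using hrel a b hab 1 1) x.toQuot
  have hF : ∀ a, F (RingQuot.mkRingHom _ a) = f' a := fun a => by
    simp only [F, RingQuot.mkRingHom_def]
    rfl
  refine ⟨AddMonoidHom.mk' F ?_, fun M => (hF _).trans (hf' M)⟩
  intro a b
  obtain ⟨a, rfl⟩ := RingQuot.mkRingHom_surjective (GrothendieckRel k H) a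
  obtain ⟨b, rfl⟩ := RingQuot.mkRingHom_surjective (GrothendieckRel k H) b
  have := hF (a + b)
  rw [map_add] at this
  exact this.trans ((map_add _ _ _).trans (congrArg₂ _ (hF a) (hF b)).symm)

end Grothendieck

end HopfRep

namespace HTwoNSq

universe u

open HopfRep

/-! ### Idempotents of H for the weights and for the eigenvalues of z -/

section Idempotents

variable {k : Type u} [Field k] {n : ℕ} {q : k}

theorem twist_apply {V : Type*} [AddCommGroup V] [Module k V] {X Y : Module.End k V} {v : V}
    {α β : k} (hX : X v = α • v) (hY : Y v = β • v) : twist n q X Y v = twist n q α β • v := by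
  have h : ∀ {X : Module.End k V} {α : k}, X v = α • v → ∀ i : ℕ, (X ^ i) v = α ^ i • v := by
    intro X α hX i
    induction i with
    | zero => simp
    | succ i ih => rw [pow_succ, Module.End.mul_apply, hX, map_smul, ih, smul_smul, pow_succ']
  simp only [twist, LinearMap.smul_apply, LinearMap.sum_apply, Module.End.mul_apply, h hY, map_smul,
    h hX, smul_eq_mul, mul_smul, Finset.sum_smul]
  congr 1
  refine Finset.sum_congr rfl fun i _ => Finset.sum_congr rfl fun j _ => ?_
  rw [smul_comm (β ^ j)]

theorem pow_eq_pow_iff (hn : 1 < n) (hq : IsPrimitiveRoot q n) {i j : ℕ} :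
    q ^ i = q ^ j ↔ i ≡ j [MOD n] := by
  have hn0 : 0 < n := by omega
  rw [pow_eq_pow_mod i hq.pow_eq_one, pow_eq_pow_mod j hq.pow_eq_one]
  exact ⟨fun h => hq.pow_inj (Nat.mod_lt i hn0) (Nat.mod_lt j hn0) h, fun h => congrArg _ h⟩

theorem map_idem {A B : Type*} [Ring A] [Algebra k A] [Ring B] [Algebra k B] (f : A →ₐ[k] B) (b : A)
    (i : ℕ) : f (idem n q b i) = idem n q (f b) i := by
  simp [idem]

theorem idem_mod (hn : 1 < n) (hq : IsPrimitiveRoot q n) {A : Type*} [Ring A] [Algebra k A] (b : A)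
    (i : ℕ) : idem n q b (i % n) = idem n q b i := by
  have h : q⁻¹ ^ (i % n) = q⁻¹ ^ i :=
    (pow_eq_pow_iff hn hq.inv).2 (Nat.mod_modEq i n)
  simp only [idem, pow_mul, h]

theorem isIdempotentElem_idem (hn : 1 < n) (hq : IsPrimitiveRoot q n) {A : Type*} [Ring A]
    [Algebra k A] {b : A} (hb : b ^ n = 1) (i : ℕ) : idem n q b i * idem n q b i = idem n q b i := by
  have hi := Nat.mod_lt i (show n > 0 by omega)
  rw [← idem_mod hn hq, idem_mul_idem hn hq hb hi hi, if_pos rfl]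

theorem idem_pow (hn : 1 < n) (hq : IsPrimitiveRoot q n) (l i : ℕ) :
    idem n q (q ^ l) i = if l ≡ i [MOD n] then 1 else 0 := by
  have hi := Nat.mod_lt i (show n > 0 by omega)
  have hl := Nat.mod_lt l (show n > 0 by omega)
  rw [← idem_mod hn hq, (pow_eq_pow_iff hn hq).2 (Nat.mod_modEq l n).symm]
  simp only [idem, smul_eq_mul, ← pow_mul, sum_root hn hq hi hl, Nat.ModEq,
    eq_comm (a := i % n)]
  congr

theorem sum_idem (hn : 1 < n) (hq : IsPrimitiveRoot q n) {A : Type*} [Ring A]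
    [Algebra k A] (b : A) : ∑ i ∈ Finset.range n, idem n q b i = 1 := by
  simpa using (twist_eq n q 1 b).symm.trans (twist_one_left hn hq b)

variable {hn : 1 < n} {hq : IsPrimitiveRoot q n}

variable (hn hq) in
/-- The idempotent projecting onto the common eigenspace of `x` and `y` with eigenvalues `q ^ a`
and `q ^ b`. -/
noncomputable def weightIdem (a b : ℕ) : H hn hq := idem n q (gen hn hq .x) a * idem n q (gen hn hq .y) b

theorem commute_idem (a b : ℕ) :
    Commute (idem n q (gen hn hq .x) a) (idem n q (gen hn hq .y) b) := by
  have h : Commute (gen hn hq .x) (gen hn hq .y) := (gen_relations hn hq).x_y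
  unfold idem
  refine Commute.smul_left (Commute.smul_right ?_ _) _
  exact Commute.sum_left _ _ _ fun i _ => Commute.sum_right _ _ _ fun j _ =>
    ((h.pow_pow i j).smul_right _).smul_left _

theorem weightIdem_mul_self (a b : ℕ) :
    weightIdem hn hq a b * weightIdem hn hq a b = weightIdem hn hq a b := by
  unfold weightIdem
  rw [mul_assoc, ← mul_assoc (idem n q (gen hn hq .y) b), ← (commute_idem a b).eq, mul_assoc,
    isIdempotentElem_idem hn hq (gen_relations hn hq).y_pow, ← mul_assoc,
    isIdempotentElem_idem hn hq (gen_relations hn hq).x_pow]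

theorem x_mul_weightIdem (a b : ℕ) :
    gen hn hq .x * weightIdem hn hq a b = q ^ a • weightIdem hn hq a b := by
  rw [weightIdem, ← mul_assoc, mul_idem hn hq (gen_relations hn hq).x_pow, smul_mul_assoc]

theorem y_mul_weightIdem (a b : ℕ) :
    gen hn hq .y * weightIdem hn hq a b = q ^ b • weightIdem hn hq a b := by
  rw [weightIdem, (commute_idem a b).eq, ← mul_assoc,
    mul_idem hn hq (gen_relations hn hq).y_pow, smul_mul_assoc]

theorem z_sq_mul_weightIdem (a b : ℕ) :
    gen hn hq .z ^ 2 * weightIdem hn hq a b = q ^ (a * b) • weightIdem hn hq a b := by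
  rw [(gen_relations hn hq).z_sq, ← twist_pow_pow hn hq]
  -- In the left regular representation the weight idempotent is itself a joint eigenvector of `x`
  -- and `y`, so `twist_apply` computes z² on it.
  have h := map_twist (Algebra.lmul k (H hn hq)) n q (gen hn hq .x) (gen hn hq .y)
  have h2 := twist_apply (n := n) (q := q) (X := Algebra.lmul k (H hn hq) (gen hn hq .x))
    (Y := Algebra.lmul k (H hn hq) (gen hn hq .y)) (x_mul_weightIdem a b) (y_mul_weightIdem a b)
  rw [← h] at h2
  exact h2

/-- Moving `z` past the product exchanges the idempotents of `x` and `y`; with equal indices this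
only reorders two commuting factors. -/
theorem commute_weightIdem_z (a : ℕ) : Commute (weightIdem hn hq a a) (gen hn hq .z) := by
  have h := gen_relations hn hq
  have key : ∀ {x y : H hn hq}, SemiconjBy (gen hn hq .z) x y →
      SemiconjBy (gen hn hq .z) (idem n q x a) (idem n q y a) := by
    intro x y hxy
    simp only [SemiconjBy, idem, mul_smul_comm, smul_mul_assoc, Finset.mul_sum, Finset.sum_mul]
    congr 1
    exact Finset.sum_congr rfl fun j _ => congrArg _ (hxy.pow_right j).eq
  have h1 := (key h.z_x).mul_right (key h.z_y)
  rw [← (commute_idem a a).eq] at h1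
  exact h1.symm

/-- The scalar `(-1)^t q^{t²/2}`. -/
noncomputable def zScalar (n : ℕ) (q : k) (t : ℕ) : k := (-1) ^ t * halfRoot n q ^ (t ^ 2)

theorem zScalar_sq (hq : IsPrimitiveRoot q n) (hodd : Odd n) (t : ℕ) :
    zScalar n q t ^ 2 = q ^ (t * t) := by
  rw [zScalar, mul_pow, ← pow_mul, ← pow_mul, mul_comm (t ^ 2), pow_mul, pow_mul (halfRoot n q),
    halfRoot_sq hq hodd, ← pow_two, ← pow_mul, mul_comm t 2, pow_mul]
  simp

theorem zScalar_ne_zero (hn : 1 < n) (hq : IsPrimitiveRoot q n) (t : ℕ) : zScalar n q t ≠ 0 :=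
  mul_ne_zero (pow_ne_zero _ (by simp)) (pow_ne_zero _ (pow_ne_zero _ (root_ne_zero hn hq)))

theorem halfRoot_pow (hq : IsPrimitiveRoot q n) : halfRoot n q ^ n = 1 := by
  rw [halfRoot, ← pow_mul, mul_comm, pow_mul, hq.pow_eq_one, one_pow]

/-- The chosen root q^{1/2} is a power of q, hence an n-th root of unity, so only the sign sees more
than the residue mod n. -/
theorem zScalar_eq_of_modEq (hq : IsPrimitiveRoot q n) {s t : ℕ} (h : s ≡ t [MOD n]) :
    zScalar n q s = (-1) ^ (s + t) * zScalar n q t := by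
  have h1 : halfRoot n q ^ (s ^ 2) = halfRoot n q ^ (t ^ 2) := by
    rw [pow_eq_pow_mod (s ^ 2) (halfRoot_pow hq), pow_eq_pow_mod (t ^ 2) (halfRoot_pow hq),
      (h.pow 2 : _ % _ = _)]
  rw [zScalar, zScalar, h1, ← mul_assoc, ← pow_add, add_assoc, ← two_mul, pow_add, pow_mul]
  simp

/-- This is s² + 2st + t² = (s+t)² in the exponent of q^{1/2}. The factor q^{st} is the one that
Δ(z) produces on a tensor product, so this identity makes `lineMod` additive in its index. -/
theorem zScalar_add (hq : IsPrimitiveRoot q n) (hodd : Odd n) (s t : ℕ) :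
    q ^ (s * t) * (zScalar n q s * zScalar n q t) = zScalar n q (s + t) := by
  have h : q ^ (s * t) = halfRoot n q ^ (2 * (s * t)) := by
    rw [pow_mul (halfRoot n q), halfRoot_sq hq hodd]
  rw [h]
  simp only [zScalar]
  ring

variable (hn hq) in
/-- The idempotent projecting onto the common eigenspace of `x`, `y` and `z` with eigenvalues
`q ^ t`, `q ^ t` and `(-1)^t q^{t²/2}`. -/
noncomputable def eigenIdem (t : ℕ) : H hn hq :=
  weightIdem hn hq t t * ((2 : k)⁻¹ • (1 + (zScalar n q t)⁻¹ • gen hn hq .z))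

/-- On the weight space (t, t), z² is the square of `zScalar n q t`. So the rescaled c • z is an
involution there, and (1 + c • z)/2 projects onto its fixed vectors. -/
theorem eigenIdem_mul_self (hodd : Odd n) (h2 : (2 : k) ≠ 0) (t : ℕ) :
    eigenIdem hn hq t * eigenIdem hn hq t = eigenIdem hn hq t := by
  set c := (zScalar n q t)⁻¹ with hc
  set E := weightIdem hn hq t t with hE
  set z := gen hn hq .z with hz
  have hcomm : Commute E z := commute_weightIdem_z t
  have hEE : E * E = E := weightIdem_mul_self t t
  have hzz : z ^ 2 * E = q ^ (t * t) • E := z_sq_mul_weightIdem t t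
  have hcq : c ^ 2 * q ^ (t * t) = 1 := by
    rw [← zScalar_sq hq hodd, ← mul_pow, hc, inv_mul_cancel₀ (zScalar_ne_zero hn hq t), one_pow]
  have hw : Commute E ((2 : k)⁻¹ • (1 + c • z)) :=
    ((Commute.one_right _).add_right (hcomm.smul_right _)).smul_right _
  have hsq : (1 + c • z) * (1 + c • z) * E = (2 : k) • ((1 + c • z) * E) := by
    have : (c • z) * (c • z) * E = E := by
      rw [smul_mul_smul_comm, ← pow_two, ← pow_two, smul_mul_assoc, hzz, smul_smul, hcq, one_smul]
    rw [add_mul 1, one_mul, mul_add, mul_one, add_mul (1 + c • z), add_mul (c • z), this, two_smul,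
      add_mul 1, one_mul]
    abel
  change E * _ * (E * _) = E * _
  rw [hw.symm.mul_mul_mul_comm, hEE, (hw.mul_right hw).eq, hw.eq, smul_mul_smul_comm,
    smul_mul_assoc, hsq, smul_smul, smul_mul_assoc]
  congr 1
  field_simp

end Idempotents

/-! ### Weight vectors in modules and in tensor products -/

section Weights

variable {k : Type u} [Field k] {n : ℕ} {q : k} {hn : 1 < n} {hq : IsPrimitiveRoot q n}

theorem isHom_of_gen {M N : FDMod k (H hn hq)} (f : M.V →ₗ[k] N.V)
    (h : ∀ g v, f (M.act (gen hn hq g) v) = N.act (gen hn hq g) (f v)) : M.IsHom N f := by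
  intro a
  induction a using H_induction with
  | halg c => intro v; simp [Module.algebraMap_end_apply]
  | hgen g => exact h g
  | hadd a b ha hb => intro v; simp only [map_add, LinearMap.add_apply, ha, hb]
  | hmul a b ha hb => intro v; simp only [map_mul, Module.End.mul_apply, ha, hb]

/-- `v` is a common eigenvector of `x` and `y` (or zero) with eigenvalues `q ^ i` and `q ^ j`. -/
structure HasWeight (M : FDMod k (H hn hq)) (v : M.V) (i j : ℕ) : Prop where
  x : M.act (gen hn hq .x) v = q ^ i • v
  y : M.act (gen hn hq .y) v = q ^ j • v

variable {M N : FDMod k (H hn hq)} {v : M.V} {w : N.V} {i j a b : ℕ}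

theorem HasWeight.z (h : HasWeight M v i j) : HasWeight M (M.act (gen hn hq .z) v) j i := by
  have hr := gen_relations hn hq
  constructor
  · rw [← Module.End.mul_apply, ← map_mul, ← hr.z_y, map_mul, Module.End.mul_apply, h.y, map_smul]
  · rw [← Module.End.mul_apply, ← map_mul, ← hr.z_x, map_mul, Module.End.mul_apply, h.x, map_smul]

theorem HasWeight.z_z (h : HasWeight M v i j) :
    M.act (gen hn hq .z) (M.act (gen hn hq .z) v) = q ^ (i * j) • v := by
  rw [← Module.End.mul_apply, ← map_mul, ← pow_two, (gen_relations hn hq).z_sq, map_twist,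
    twist_apply h.x h.y, twist_pow_pow hn hq]

theorem HasWeight.eq_zero (h : HasWeight M v i j) (h' : HasWeight M v a b)
    (hne : ¬ i ≡ a [MOD n]) : v = 0 := by
  have h1 : (q ^ i - q ^ a) • v = 0 := by rw [sub_smul, ← h.x, ← h'.x, sub_self]
  rcases smul_eq_zero.1 h1 with h2 | h2
  · exact absurd ((pow_eq_pow_iff hn hq).1 (sub_eq_zero.1 h2)) hne
  · exact h2

theorem hasWeight_weightIdem (M : FDMod k (H hn hq)) (v : M.V) (a b : ℕ) :
    HasWeight M (M.act (weightIdem hn hq a b) v) a b := by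
  constructor
  · rw [← Module.End.mul_apply, ← map_mul, x_mul_weightIdem, map_smul, LinearMap.smul_apply]
  · rw [← Module.End.mul_apply, ← map_mul, y_mul_weightIdem, map_smul, LinearMap.smul_apply]

/-- The weight idempotents sum to 1, so one of them does not kill a given nonzero vector. -/
theorem exists_hasWeight [Nontrivial M.V] : ∃ (v : M.V) (i j : ℕ), v ≠ 0 ∧ HasWeight M v i j := by
  obtain ⟨v, hv⟩ := exists_ne (0 : M.V)
  by_contra! hcon
  apply hv
  have h0 : ∀ i j, M.act (weightIdem hn hq i j) v = 0 := by
    intro i j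
    by_contra hne
    exact hcon _ i j hne (hasWeight_weightIdem M v i j)
  have h1 : (1 : H hn hq) = ∑ i ∈ Finset.range n, ∑ j ∈ Finset.range n, weightIdem hn hq i j := by
    simp only [weightIdem, ← Finset.mul_sum, sum_idem hn hq, mul_one]
  calc v = M.act 1 v := by simp
    _ = 0 := by
      rw [h1, map_sum, LinearMap.sum_apply]
      refine Finset.sum_eq_zero fun i _ => ?_
      rw [map_sum, LinearMap.sum_apply]
      exact Finset.sum_eq_zero fun j _ => h0 i j

/-- The vector `v ⊗ w` of the tensor product of two modules. -/
def tmulVec (v : M.V) (w : N.V) : (M.tensor N).V := v ⊗ₜ[k] w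

theorem tensor_act_of_comul {h : H hn hq} (hh : Coalgebra.comul (R := k) h = h ⊗ₜ[k] h) (v : M.V)
    (w : N.V) : (M.tensor N).act h (tmulVec v w) = tmulVec (M.act h v) (N.act h w) := by
  change extAct M.act N.act (Coalgebra.comul h) (v ⊗ₜ[k] w) = _
  rw [hh, extAct_tmul]
  rfl

theorem tmulVec_smul_smul (v : M.V) (w : N.V) (c d : k) :
    tmulVec (c • v) (d • w) = (c * d) • tmulVec v w :=
  TensorProduct.smul_tmul_smul c d v w

theorem smul_tmulVec (v : M.V) (w : N.V) (c : k) : tmulVec (c • v) w = c • tmulVec v w := rfl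

theorem tmulVec_smul (v : M.V) (w : N.V) (c : k) : tmulVec v (c • w) = c • tmulVec v w :=
  TensorProduct.tmul_smul c v w

theorem HasWeight.tmul (hv : HasWeight M v i j) (hw : HasWeight N w a b) :
    HasWeight (M.tensor N) (tmulVec v w) (i + a) (j + b) := by
  constructor
  · rw [tensor_act_of_comul (comul_x hn hq), hv.x, hw.x, tmulVec_smul_smul, pow_add]
  · rw [tensor_act_of_comul (comul_y hn hq), hv.y, hw.y, tmulVec_smul_smul, pow_add]

/-- Δ(z) is the twist of x ⊗ 1 and 1 ⊗ y times z ⊗ z. After `z` has swapped the weights, x ⊗ 1 has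
eigenvalue q^j and 1 ⊗ y has q^a, and the twist of these two scalars is q^{ja}. -/
theorem HasWeight.z_tmul (hv : HasWeight M v i j) (hw : HasWeight N w a b) :
    (M.tensor N).act (gen hn hq .z) (tmulVec v w) =
      q ^ (j * a) • tmulVec (M.act (gen hn hq .z) v) (N.act (gen hn hq .z) w) := by
  change extAct M.act N.act (Coalgebra.comul (gen hn hq .z)) (v ⊗ₜ[k] w) =
    (q ^ (j * a) • (M.act (gen hn hq .z) v ⊗ₜ[k] N.act (gen hn hq .z) w) : M.V ⊗[k] N.V)
  rw [comul_z, comulZ_eq, map_mul, map_twist, Module.End.mul_apply, extAct_tmul,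
    ← twist_pow_pow hn hq]
  apply twist_apply
  · simp [hv.z.x, TensorProduct.smul_tmul']
  · simp [hw.z.y]

end Weights

end HTwoNSq

namespace HTwoNSq

universe u

open HopfRep Matrix

/-! ### The modules `lineMod t` and `S₂ i j` and their products -/

section Simple

variable {k : Type u} [Field k] {n : ℕ} {q : k}

theorem zScalar_relations (hn : 1 < n) (hq : IsPrimitiveRoot q n) (hodd : Odd n) (t : ℕ) :
    Relations n q (q ^ t) (q ^ t) (zScalar n q t) := by
  have hp : (q ^ t) ^ n = 1 := by rw [← pow_mul, mul_comm, pow_mul, hq.pow_eq_one, one_pow]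
  exact ⟨hp, hp, rfl, mul_comm _ _, mul_comm _ _, by
    rw [zScalar_sq hq hodd, twist_pow_pow hn hq]⟩

/-- The one-dimensional module on which `x` and `y` act as `q ^ t` and `z` as `(-1)^t q^{t²/2}`. -/
noncomputable def lineMod (hn : 1 < n) (hq : IsPrimitiveRoot q n) (hodd : Odd n) (t : ℕ) :
    FDMod k (H hn hq) where
  V := k
  act := (Algebra.ofId k (Module.End k k)).comp (lift (zScalar_relations hn hq hodd t))

variable {hn : 1 < n} {hq : IsPrimitiveRoot q n} {hodd : Odd n}

theorem lineMod_act (t : ℕ) (h : H hn hq) (c : k) :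
    (lineMod hn hq hodd t).act h c = (lift (zScalar_relations hn hq hodd t) h * c : k) := rfl

/-- The basis vector of the one-dimensional module. -/
def lineMod.e (hn : 1 < n) (hq : IsPrimitiveRoot q n) (hodd : Odd n) (t : ℕ) :
    (lineMod hn hq hodd t).V := (1 : k)

theorem hasWeight_lineMod_e (t : ℕ) : HasWeight (lineMod hn hq hodd t) (lineMod.e hn hq hodd t) t t :=
  ⟨by rw [lineMod.e, lineMod_act, lift_x]; rfl, by rw [lineMod.e, lineMod_act, lift_y]; rfl⟩

theorem z_lineMod_e (t : ℕ) : (lineMod hn hq hodd t).act (gen hn hq .z) (lineMod.e hn hq hodd t) =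
    zScalar n q t • lineMod.e hn hq hodd t := by
  rw [lineMod.e, lineMod_act, lift_z]
  rfl

theorem span_lineMod_e (t : ℕ) : ⊤ ≤ Submodule.span k {lineMod.e hn hq hodd t} := by
  intro (c : k) _
  exact Submodule.mem_span_singleton.2 ⟨c, mul_one c⟩

theorem exists_hom_lineMod (M : FDMod k (H hn hq)) {v : M.V} {t : ℕ} (hv : HasWeight M v t t)
    (hz : M.act (gen hn hq .z) v = zScalar n q t • v) :
    ∃ f : (lineMod hn hq hodd t).V →ₗ[k] M.V, (lineMod hn hq hodd t).IsHom M f ∧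
      ∀ c : k, f c = c • v := by
  refine ⟨LinearMap.toSpanSingleton k M.V v, isHom_of_gen _ ?_, fun _ => rfl⟩
  intro g (c : k)
  change LinearMap.toSpanSingleton k M.V v _ = M.act _ (c • v)
  cases g
  · rw [lineMod_act, lift_x, map_smul, hv.x, LinearMap.toSpanSingleton_apply, mul_comm, mul_smul]
  · rw [lineMod_act, lift_y, map_smul, hv.y, LinearMap.toSpanSingleton_apply, mul_comm, mul_smul]
  · rw [lineMod_act, lift_z, map_smul, hz, LinearMap.toSpanSingleton_apply, mul_comm, mul_smul]

/-- Both modules have z = -q^{1/2}: the sign σ(n+1) is -1, and (n+1)² ≡ 1 mod n. -/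
theorem cls_S_succ (hn3 : 3 ≤ n) : cls (S hn hq hodd (n + 1)) = cls (lineMod hn hq hodd 1) := by
  have hs : sign n (n + 1) = -1 := by
    rw [sign, if_neg]
    rw [Nat.mod_eq_of_lt (by omega)]
    omega
  have hpow : halfRoot n q ^ ((n + 1) ^ 2) = halfRoot n q := by
    rw [show (n + 1) ^ 2 = n * (n + 2) + 1 by ring, pow_succ, pow_mul, halfRoot_pow hq, one_pow,
      one_mul]
  have h : lift (hn := hn) (hq := hq) (one_dim_relations hn hq hodd (n + 1)) =
      lift (zScalar_relations hn hq hodd 1) := by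
    apply algHom_ext
    · rw [lift_x, lift_x, pow_succ, hq.pow_eq_one, one_mul, pow_one]
    · rw [lift_y, lift_y, pow_succ, hq.pow_eq_one, one_mul, pow_one]
    · rw [lift_z, lift_z, hs, hpow, zScalar]
      simp
  unfold S lineMod
  rw [h]

theorem cls_lineMod_zero : cls (lineMod hn hq hodd 0) = 1 := by
  rw [← cls_triv]
  apply cls_eq_of_iso
  refine ⟨LinearEquiv.refl k k, isHom_of_gen _ ?_⟩
  intro g (c : k)
  change (lineMod hn hq hodd 0).act _ c = trivAct k (H hn hq) _ c
  rw [trivAct_apply, counit_gen]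
  cases g
  · rw [lineMod_act, lift_x, pow_zero]
  · rw [lineMod_act, lift_y, pow_zero]
  · rw [lineMod_act, lift_z, zScalar, pow_zero, one_mul, zero_pow two_ne_zero, pow_zero]

theorem S₂_act (i j : ℕ) (h : H hn hq) (v : Fin 2 → k) :
    (S₂ hn hq i j).act h v = lift (two_dim_relations hn hq i j) h *ᵥ v := rfl

/-- The first standard basis vector of `S_{i,j}`. -/
def S₂.e (hn : 1 < n) (hq : IsPrimitiveRoot q n) (i j : ℕ) : (S₂ hn hq i j).V := (![1, 0] : Fin 2 → k)

theorem hasWeight_e (i j : ℕ) : HasWeight (S₂ hn hq i j) (S₂.e hn hq i j) i j := by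
  constructor
  · suffices h : lift (two_dim_relations hn hq i j) (gen hn hq .x) *ᵥ (![1, 0] : Fin 2 → k) =
      q ^ i • (![1, 0] : Fin 2 → k) from h
    rw [lift_x]
    ext a
    fin_cases a <;> simp [Matrix.mulVec_diagonal]
  · suffices h : lift (two_dim_relations hn hq i j) (gen hn hq .y) *ᵥ (![1, 0] : Fin 2 → k) =
      q ^ j • (![1, 0] : Fin 2 → k) from h
    rw [lift_y]
    ext a
    fin_cases a <;> simp [Matrix.mulVec_diagonal]

theorem z_e (i j : ℕ) :
    (S₂ hn hq i j).act (gen hn hq .z) (S₂.e hn hq i j) = (![0, 1] : Fin 2 → k) := by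
  change lift (two_dim_relations hn hq i j) _ *ᵥ ![1, 0] = _
  rw [lift_z]
  ext a
  fin_cases a <;> simp [Matrix.mulVec, dotProduct]

/-- Since `z` swaps the weights and z² is the scalar q^{ij}, the span of v and zv is a submodule
with the structure constants of `S₂ i j`. Thus `S₂ i j` is universal for vectors of weight (i, j),
also when i ≡ j. -/
theorem exists_hom_S₂ (M : FDMod k (H hn hq)) {v : M.V} {i j : ℕ} (hv : HasWeight M v i j) :
    ∃ f : (S₂ hn hq i j).V →ₗ[k] M.V, (S₂ hn hq i j).IsHom M f ∧
      ∀ c : Fin 2 → k, f c = c 0 • v + c 1 • M.act (gen hn hq .z) v := by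
  let f : (Fin 2 → k) →ₗ[k] M.V := (LinearMap.proj 0).smulRight v +
    (LinearMap.proj 1).smulRight (M.act (gen hn hq .z) v)
  refine ⟨f, isHom_of_gen _ ?_, fun _ => rfl⟩
  intro g (c : Fin 2 → k)
  have hf : ∀ c, f c = c 0 • v + c 1 • M.act (gen hn hq .z) v := fun _ => rfl
  refine (hf _).trans (Eq.trans ?_ (congrArg _ (hf c)).symm)
  rw [map_add, map_smul, map_smul]
  cases g
  · rw [hv.x, hv.z.x, S₂_act, lift_x, mulVec_diagonal, mulVec_diagonal, smul_smul, smul_smul,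
      mul_comm (c 0), mul_comm (c 1)]
    rfl
  · rw [hv.y, hv.z.y, S₂_act, lift_y, mulVec_diagonal, mulVec_diagonal, smul_smul, smul_smul,
      mul_comm (c 0), mul_comm (c 1)]
    rfl
  · rw [hv.z_z, S₂_act, lift_z, smul_smul, mul_comm (c 1), add_comm]
    simp [Matrix.mulVec, dotProduct]

theorem finrank_S₂ (i j : ℕ) : Module.finrank k (S₂ hn hq i j).V = 2 := by
  change Module.finrank k (Fin 2 → k) = 2
  simp

theorem finrank_lineMod (t : ℕ) : Module.finrank k (lineMod hn hq hodd t).V = 1 := by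
  change Module.finrank k k = 1
  simp

theorem S₂_iso_of_span {M : FDMod k (H hn hq)} {v : M.V} {i j : ℕ} (hv : HasWeight M v i j)
    (hd : Module.finrank k M.V = 2)
    (hs : ⊤ ≤ Submodule.span k {v, M.act (gen hn hq .z) v}) : (S₂ hn hq i j).Iso M := by
  obtain ⟨f, hf, hfc⟩ := exists_hom_S₂ M hv
  refine FDMod.iso_of_surjective f hf ?_ (by rw [finrank_S₂, hd])
  intro y
  obtain ⟨a, b, rfl⟩ := Submodule.mem_span_pair.1 (hs (Submodule.mem_top (x := y)))
  exact ⟨(![a, b] : Fin 2 → k), hfc _⟩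

theorem span_e (i j : ℕ) :
    ⊤ ≤ Submodule.span k {S₂.e hn hq i j, (S₂ hn hq i j).act (gen hn hq .z) (S₂.e hn hq i j)} := by
  intro (y : Fin 2 → k) _
  refine Submodule.mem_span_pair.2 ⟨y 0, y 1, ?_⟩
  rw [z_e]
  suffices h : y 0 • (![1, 0] : Fin 2 → k) + y 1 • (![0, 1] : Fin 2 → k) = y from h
  ext a
  fin_cases a <;> simp

theorem cls_S₂_congr {i j a b : ℕ} (h1 : i ≡ a [MOD n]) (h2 : j ≡ b [MOD n]) :
    cls (S₂ hn hq i j) = cls (S₂ hn hq a b) := by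
  apply cls_eq_of_iso
  have h := hasWeight_e (hn := hn) (hq := hq) a b
  refine S₂_iso_of_span (v := S₂.e hn hq a b) ⟨?_, ?_⟩ (finrank_S₂ _ _) (span_e _ _)
  · rw [(pow_eq_pow_iff hn hq).2 h1, h.x]
  · rw [(pow_eq_pow_iff hn hq).2 h2, h.y]

/-- The vector ze has the swapped weight and still generates, because z²e is a nonzero multiple of
e. -/
theorem cls_S₂_comm (i j : ℕ) : cls (S₂ hn hq i j) = cls (S₂ hn hq j i) := by
  apply cls_eq_of_iso
  have h := hasWeight_e (hn := hn) (hq := hq) j i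
  refine S₂_iso_of_span h.z (finrank_S₂ _ _) ((span_e j i).trans ?_)
  rw [h.z_z, Submodule.span_le]
  rintro _ (rfl | rfl)
  · refine Submodule.mem_span_pair.2 ⟨0, (q ^ (j * i))⁻¹, ?_⟩
    rw [zero_smul, zero_add, smul_smul, inv_mul_cancel₀ (pow_ne_zero _ (root_ne_zero hn hq)),
      one_smul]
  · exact Submodule.subset_span (Set.mem_insert _ _)

theorem lineMod_iso_of_span {M : FDMod k (H hn hq)} {v : M.V} {t : ℕ} (hv : HasWeight M v t t)
    (hz : M.act (gen hn hq .z) v = zScalar n q t • v) (hd : Module.finrank k M.V = 1)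
    (hs : ⊤ ≤ Submodule.span k {v}) : (lineMod hn hq hodd t).Iso M := by
  obtain ⟨f, hf, hfc⟩ := exists_hom_lineMod (hodd := hodd) M hv hz
  refine FDMod.iso_of_surjective f hf ?_ (by rw [finrank_lineMod, hd])
  intro y
  obtain ⟨a, rfl⟩ := Submodule.mem_span_singleton.1 (hs (Submodule.mem_top (x := y)))
  exact ⟨(a : k), hfc _⟩

theorem cls_eq_add_of_span {M : FDMod k (H hn hq)} {v w : M.V} {i j a b : ℕ}
    (hv : HasWeight M v i j) (hw : HasWeight M w a b) (hd : Module.finrank k M.V = 4)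
    (hs : ⊤ ≤ Submodule.span k {v, M.act (gen hn hq .z) v} ⊔
      Submodule.span k {w, M.act (gen hn hq .z) w}) :
    cls M = cls (S₂ hn hq i j) + cls (S₂ hn hq a b) := by
  obtain ⟨f, hf, hfc⟩ := exists_hom_S₂ M hv
  obtain ⟨g, hg, hgc⟩ := exists_hom_S₂ M hw
  rw [← cls_prod]
  symm
  apply cls_eq_of_iso
  refine FDMod.iso_of_surjective (f.coprod g) ?_ ?_ ?_
  · intro h c
    have hfg : ∀ c : ((S₂ hn hq i j).prod (S₂ hn hq a b)).V, f.coprod g c = f c.1 + g c.2 :=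
      fun _ => rfl
    refine (hfg _).trans (Eq.trans ?_ (congrArg _ (hfg c)).symm)
    rw [map_add, ← hf, ← hg]
    rfl
  · intro y
    obtain ⟨y₁, h₁, y₂, h₂, rfl⟩ := Submodule.mem_sup.1 (hs (Submodule.mem_top (x := y)))
    obtain ⟨a₁, b₁, rfl⟩ := Submodule.mem_span_pair.1 h₁
    obtain ⟨a₂, b₂, rfl⟩ := Submodule.mem_span_pair.1 h₂
    exact ⟨((![a₁, b₁] : Fin 2 → k), (![a₂, b₂] : Fin 2 → k)), congrArg₂ _ (hfc _) (hgc _)⟩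
  · refine (Module.finrank_prod (R := k)).trans ?_
    rw [finrank_S₂, finrank_S₂, hd]

section TmulVec

variable {M N : FDMod k (H hn hq)} {v : M.V} {w : N.V} {i j a b : ℕ}

theorem finrank_tensor : Module.finrank k (M.tensor N).V =
    Module.finrank k M.V * Module.finrank k N.V :=
  Module.finrank_tensorProduct (R := k) (S := k)

theorem span_tmul {s : Set M.V} {t : Set N.V} (hs : ⊤ ≤ Submodule.span k s)
    (ht : ⊤ ≤ Submodule.span k t) : ⊤ ≤ Submodule.span k (Set.image2 tmulVec s t) := by
  have h := Submodule.map₂_span_span k (TensorProduct.mk k M.V N.V) s t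
  rw [top_le_iff.1 hs, top_le_iff.1 ht, TensorProduct.map₂_mk_top_top_eq_top] at h
  exact h.le

theorem mem_span_of_smul {V : Type*} [AddCommGroup V] [Module k V] {s : Set V} {c : k} {v : V}
    (hc : c ≠ 0) (h : c • v ∈ Submodule.span k s) : v ∈ Submodule.span k s := by
  simpa [smul_smul, hc] using Submodule.smul_mem _ c⁻¹ h

end TmulVec

theorem cls_lineMod_mul_cls_lineMod (s t : ℕ) :
    cls (lineMod hn hq hodd s) * cls (lineMod hn hq hodd t) = cls (lineMod hn hq hodd (s + t)) := by
  rw [← cls_tensor]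
  symm
  apply cls_eq_of_iso
  have h1 := hasWeight_lineMod_e (hn := hn) (hq := hq) (hodd := hodd) s
  have h2 := hasWeight_lineMod_e (hn := hn) (hq := hq) (hodd := hodd) t
  refine lineMod_iso_of_span (v := tmulVec _ _) (h1.tmul h2) ?_ ?_
    ((span_tmul (span_lineMod_e s) (span_lineMod_e t)).trans ?_)
  · rw [h1.z_tmul h2, z_lineMod_e, z_lineMod_e, tmulVec_smul_smul, smul_smul, zScalar_add hq hodd]
  · rw [finrank_tensor, finrank_lineMod, finrank_lineMod]
  · rw [Set.image2_singleton]

theorem cls_lineMod_mul_cls_S₂ (t i j : ℕ) :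
    cls (lineMod hn hq hodd t) * cls (S₂ hn hq i j) = cls (S₂ hn hq (t + i) (t + j)) := by
  rw [← cls_tensor]
  symm
  apply cls_eq_of_iso
  have h1 := hasWeight_lineMod_e (hn := hn) (hq := hq) (hodd := hodd) t
  have h2 := hasWeight_e (hn := hn) (hq := hq) i j
  refine S₂_iso_of_span (v := tmulVec _ _) (h1.tmul h2) ?_
    ((span_tmul (span_lineMod_e t) (span_e i j)).trans ?_)
  · rw [finrank_tensor, finrank_lineMod, finrank_S₂]
  · rw [h1.z_tmul h2, Submodule.span_le]
    rintro _ ⟨_, rfl, _, rfl | rfl, rfl⟩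
    · exact Submodule.subset_span (Set.mem_insert _ _)
    · refine mem_span_of_smul (c := q ^ (t * i) * zScalar n q t) (mul_ne_zero
        (pow_ne_zero _ (root_ne_zero hn hq)) (zScalar_ne_zero hn hq t)) ?_
      apply Submodule.subset_span
      right
      rw [z_lineMod_e, smul_tmulVec, smul_smul]
      rfl

theorem cls_S₂_mul_cls_lineMod (t i j : ℕ) :
    cls (S₂ hn hq i j) * cls (lineMod hn hq hodd t) = cls (S₂ hn hq (i + t) (j + t)) := by
  rw [← cls_tensor]
  symm
  apply cls_eq_of_iso
  have h1 := hasWeight_lineMod_e (hn := hn) (hq := hq) (hodd := hodd) t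
  have h2 := hasWeight_e (hn := hn) (hq := hq) i j
  refine S₂_iso_of_span (v := tmulVec _ _) (h2.tmul h1) ?_
    ((span_tmul (span_e i j) (span_lineMod_e t)).trans ?_)
  · rw [finrank_tensor, finrank_lineMod, finrank_S₂]
  · rw [h2.z_tmul h1, Submodule.span_le]
    rintro _ ⟨_, rfl | rfl, _, rfl, rfl⟩
    · exact Submodule.subset_span (Set.mem_insert _ _)
    · refine mem_span_of_smul (c := q ^ (j * t) * zScalar n q t) (mul_ne_zero
        (pow_ne_zero _ (root_ne_zero hn hq)) (zScalar_ne_zero hn hq t)) ?_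
      apply Submodule.subset_span
      right
      rw [z_lineMod_e, tmulVec_smul, smul_smul]
      rfl

/-- With generators v and w, the vectors v ⊗ w and v ⊗ zw have the two weights on the right. Up to
nonzero scalars `z` sends them to zv ⊗ zw and zv ⊗ w, so together they generate the whole tensor
product. -/
theorem cls_S₂_mul_cls_S₂ (i j a b : ℕ) :
    cls (S₂ hn hq i j) * cls (S₂ hn hq a b) =
      cls (S₂ hn hq (i + a) (j + b)) + cls (S₂ hn hq (i + b) (j + a)) := by
  rw [← cls_tensor]
  have h1 := hasWeight_e (hn := hn) (hq := hq) i j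
  have h2 := hasWeight_e (hn := hn) (hq := hq) a b
  have hne : ∀ l, q ^ l ≠ 0 := fun l => pow_ne_zero _ (root_ne_zero hn hq)
  refine cls_eq_add_of_span (v := tmulVec _ _) (w := tmulVec _ _) (h1.tmul h2) (h1.tmul h2.z) ?_
    ((span_tmul (span_e i j) (span_e a b)).trans ?_)
  · rw [finrank_tensor, finrank_S₂, finrank_S₂]
  · rw [h1.z_tmul h2, h1.z_tmul h2.z, h2.z_z, tmulVec_smul, smul_smul, Submodule.span_le]
    rintro _ ⟨_, rfl | rfl, _, rfl | rfl, rfl⟩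
    · exact Submodule.mem_sup_left (Submodule.subset_span (Set.mem_insert _ _))
    · exact Submodule.mem_sup_right (Submodule.subset_span (Set.mem_insert _ _))
    · refine Submodule.mem_sup_right (mem_span_of_smul (c := q ^ (j * b) * q ^ (a * b))
        (mul_ne_zero (hne _) (hne _)) (Submodule.subset_span ?_))
      right
      rfl
    · refine Submodule.mem_sup_left (mem_span_of_smul (c := q ^ (j * a))
        (hne _) (Submodule.subset_span ?_))
      right
      rfl

/-- On `S₂ 0 0` the elements `x` and `y` act trivially and `z` exchanges the coordinates. The
diagonal is the trivial module. The difference of coordinates maps onto the line where z = -1, which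
is `lineMod n` because n is odd. -/
theorem cls_S₂_zero_zero : cls (S₂ hn hq 0 0) = 1 + cls (lineMod hn hq hodd n) := by
  have hz0 : zScalar n q 0 = 1 := by simp [zScalar]
  have hzn : zScalar n q n = -1 := by
    rw [zScalar, hodd.neg_one_pow, pow_two, pow_mul, halfRoot_pow hq, one_pow, mul_one]
  rw [← cls_lineMod_zero (hodd := hodd)]
  let f : k →ₗ[k] (Fin 2 → k) := LinearMap.pi fun _ : Fin 2 => (LinearMap.id : k →ₗ[k] k)
  let g : (Fin 2 → k) →ₗ[k] k :=
    (LinearMap.proj 0 : (Fin 2 → k) →ₗ[k] k) - LinearMap.proj 1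
  have hf : ∀ c a, f c a = c := fun _ _ => rfl
  have hg : ∀ c, g c = c 0 - c 1 := fun _ => rfl
  refine cls_of_shortExact ⟨f, g, isHom_of_gen _ ?_, isHom_of_gen _ ?_, ?_, ?_, ?_⟩
  · intro l (c : k)
    refine funext fun a => (hf _ a).trans ?_
    change _ = (lift (two_dim_relations hn hq 0 0) (gen hn hq l) *ᵥ f c) a
    cases l
    · rw [lift_x, lineMod_act, lift_x, mulVec_diagonal, hf]
      fin_cases a <;> rfl
    · rw [lift_y, lineMod_act, lift_y, mulVec_diagonal, hf]
      fin_cases a <;> rfl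
    · rw [lift_z, lineMod_act, lift_z, hz0]
      fin_cases a <;> simp [Matrix.mulVec, dotProduct, hf]
  · intro l (c : Fin 2 → k)
    refine (hg _).trans ?_
    change (lift (two_dim_relations hn hq 0 0) (gen hn hq l) *ᵥ c) 0 -
      (lift (two_dim_relations hn hq 0 0) (gen hn hq l) *ᵥ c) 1 =
      lift (zScalar_relations hn hq hodd n) (gen hn hq l) * (c 0 - c 1)
    cases l
    · rw [lift_x, lift_x, hq.pow_eq_one]
      simp [mulVec_diagonal]
    · rw [lift_y, lift_y, hq.pow_eq_one]
      simp [mulVec_diagonal]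
    · rw [lift_z, lift_z, hzn]
      simp [Matrix.mulVec, dotProduct]
  · exact fun c d hcd => congrFun hcd 0
  · intro (c : k)
    exact ⟨(![c, 0] : Fin 2 → k), sub_zero c⟩
  · intro (c : Fin 2 → k)
    refine (Eq.congr_left (hg c)).trans ?_
    constructor
    · intro hc
      have hc' : c 0 = c 1 := sub_eq_zero.1 hc
      refine ⟨(c 0 : k), funext fun a => ?_⟩
      fin_cases a
      · rfl
      · exact hc'
    · rintro ⟨d, rfl⟩
      exact sub_self (d : k)

end Simple

end HTwoNSq

namespace HTwoNSq

universe u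

open HopfRep Matrix

/-! ### Ranks of the idempotents on `lineMod t` and `S₂ i j` -/

section Ranks

variable {k : Type u} [Field k] {n : ℕ} {q : k} {hn : 1 < n} {hq : IsPrimitiveRoot q n}
  {hodd : Odd n}

theorem idem_diagonal (hn : 1 < n) (hq : IsPrimitiveRoot q n) (i j a : ℕ) :
    idem n q (diagonal ![q ^ i, q ^ j]) a =
      diagonal ![if i ≡ a [MOD n] then 1 else 0, if j ≡ a [MOD n] then 1 else 0] := by
  have h1 := map_idem (n := n) (q := q) (diagonalAlgHom k : (Fin 2 → k) →ₐ[k] Matrix (Fin 2) (Fin 2) k)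
    ![q ^ i, q ^ j] a
  simp only [diagonalAlgHom_apply] at h1
  rw [← h1]
  congr 1
  ext c
  have h2 := map_idem (n := n) (q := q) (Pi.evalAlgHom k (fun _ : Fin 2 => k) c) ![q ^ i, q ^ j] a
  simp only [Pi.evalAlgHom_apply] at h2
  rw [h2]
  fin_cases c
  · exact idem_pow hn hq i a
  · exact idem_pow hn hq j a

theorem lift_weightIdem (i j a b : ℕ) :
    lift (two_dim_relations hn hq i j) (weightIdem hn hq a b) =
      diagonal ![if i ≡ a [MOD n] ∧ j ≡ b [MOD n] then 1 else 0,
        if j ≡ a [MOD n] ∧ i ≡ b [MOD n] then 1 else 0] := by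
  rw [weightIdem, map_mul, map_idem, map_idem, lift_x, lift_y, idem_diagonal hn hq,
    idem_diagonal hn hq, diagonal_mul_diagonal]
  congr 1
  ext c
  fin_cases c
  · by_cases h1 : i ≡ a [MOD n] <;> by_cases h2 : j ≡ b [MOD n] <;> simp [h1, h2]
  · by_cases h1 : j ≡ a [MOD n] <;> by_cases h2 : i ≡ b [MOD n] <;> simp [h1, h2]

theorem rk_S₂ (i j : ℕ) (e : H hn hq) :
    (S₂ hn hq i j).rk e = (lift (two_dim_relations hn hq i j) e).rank := rfl

/-- The two standard basis vectors have weights (i, j) and (j, i); each contributes one summand. -/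
theorem rk_weightIdem_S₂ (i j a b : ℕ) : (S₂ hn hq i j).rk (weightIdem hn hq a b) =
    (if i ≡ a [MOD n] ∧ j ≡ b [MOD n] then 1 else 0) +
      (if j ≡ a [MOD n] ∧ i ≡ b [MOD n] then 1 else 0) := by
  classical
  rw [rk_S₂, lift_weightIdem, rank_diagonal, Fintype.card_subtype, Finset.card_filter,
    Fin.sum_univ_two]
  simp

theorem rk_eigenIdem_S₂ {i j : ℕ} (t : ℕ) (hij : ¬ i ≡ j [MOD n]) :
    (S₂ hn hq i j).rk (eigenIdem hn hq t) = 0 := by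
  have h1 : ¬ (i ≡ t [MOD n] ∧ j ≡ t [MOD n]) := fun h => hij (h.1.trans h.2.symm)
  have h2 : ¬ (j ≡ t [MOD n] ∧ i ≡ t [MOD n]) := fun h => hij (h.2.trans h.1.symm)
  have h3 : (diagonal ![0, 0] : Matrix (Fin 2) (Fin 2) k) = 0 := by
    rw [← diagonal_zero]
    congr 1
    ext c
    fin_cases c <;> rfl
  rw [rk_S₂, eigenIdem, map_mul, lift_weightIdem, if_neg h1, if_neg h2, h3, zero_mul, rank_zero]

theorem rk_lineMod_of_eq_zero {t : ℕ} {e : H hn hq}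
    (h : lift (zScalar_relations hn hq hodd t) e = 0) : (lineMod hn hq hodd t).rk e = 0 := by
  have : (lineMod hn hq hodd t).act e = 0 := by
    refine LinearMap.ext fun (c : k) => ?_
    rw [lineMod_act, h, zero_mul]
    rfl
  rw [FDMod.rk, this, LinearMap.range_zero, finrank_bot]

theorem rk_lineMod_of_eq_one {t : ℕ} {e : H hn hq}
    (h : lift (zScalar_relations hn hq hodd t) e = 1) : (lineMod hn hq hodd t).rk e = 1 := by
  have : (lineMod hn hq hodd t).act e = LinearMap.id := by
    refine LinearMap.ext fun (c : k) => ?_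
    rw [lineMod_act, h, one_mul]
    rfl
  rw [FDMod.rk, this, LinearMap.range_id, finrank_top, finrank_lineMod]

theorem lift_weightIdem_lineMod (t a b : ℕ) :
    lift (zScalar_relations hn hq hodd t) (weightIdem hn hq a b) =
      if t ≡ a [MOD n] ∧ t ≡ b [MOD n] then 1 else 0 := by
  rw [weightIdem, map_mul, map_idem, map_idem, lift_x, lift_y, idem_pow hn hq, idem_pow hn hq]
  by_cases h1 : t ≡ a [MOD n] <;> by_cases h2 : t ≡ b [MOD n] <;> simp [h1, h2]

theorem rk_weightIdem_lineMod (t : ℕ) {a b : ℕ} (hab : ¬ a ≡ b [MOD n]) :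
    (lineMod hn hq hodd t).rk (weightIdem hn hq a b) = 0 := by
  apply rk_lineMod_of_eq_zero
  rw [lift_weightIdem_lineMod (hodd := hodd), if_neg]
  exact fun h => hab (h.1.symm.trans h.2)

/-- The weight part tests s ≡ t mod n; the factor (1 + c • z)/2 then becomes (1 + (-1)^{s+t})/2 and
tests parity. As n is odd, the two together amount to a congruence mod 2n. -/
theorem rk_eigenIdem_lineMod (h2 : (2 : k) ≠ 0) (s t : ℕ) :
    (lineMod hn hq hodd s).rk (eigenIdem hn hq t) = if s ≡ t [MOD 2 * n] then 1 else 0 := by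
  have hco : Nat.Coprime 2 n := hodd.coprime_two_left
  have hiff := Nat.modEq_and_modEq_iff_modEq_mul (a := s) (b := t) hco
  have hl : lift (zScalar_relations hn hq hodd s) (eigenIdem hn hq t) =
      (if s ≡ t [MOD n] ∧ s ≡ t [MOD n] then 1 else 0) *
        ((2 : k)⁻¹ * (1 + (zScalar n q t)⁻¹ * zScalar n q s)) := by
    rw [eigenIdem, map_mul, lift_weightIdem_lineMod (hodd := hodd), map_smul, map_add, map_one, map_smul, lift_z]
    rfl
  by_cases hst : s ≡ t [MOD n]
  · have hz : (zScalar n q t)⁻¹ * zScalar n q s = (-1) ^ (s + t) := by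
      rw [zScalar_eq_of_modEq hq hst, mul_left_comm, inv_mul_cancel₀ (zScalar_ne_zero hn hq t),
        mul_one]
    rw [if_pos ⟨hst, hst⟩, one_mul, hz] at hl
    by_cases hp : s ≡ t [MOD 2]
    · rw [if_pos (hiff.1 ⟨hp, hst⟩)]
      apply rk_lineMod_of_eq_one
      have : Even (s + t) := by
        rw [Nat.even_iff]
        unfold Nat.ModEq at hp
        omega
      rw [hl, this.neg_one_pow, one_add_one_eq_two, inv_mul_cancel₀ h2]
    · rw [if_neg fun h => hp (hiff.2 h).1]
      apply rk_lineMod_of_eq_zero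
      have : Odd (s + t) := by
        rw [Nat.odd_iff]
        unfold Nat.ModEq at hp
        omega
      rw [hl, this.neg_one_pow, add_neg_cancel, mul_zero]
  · rw [if_neg fun h => hst (hiff.2 h).2]
    apply rk_lineMod_of_eq_zero
    rw [hl, if_neg fun h => hst h.1, zero_mul]

end Ranks

/-! ### Submodules of the standard form and generation of the Grothendieck group -/

section Generation

variable {k : Type u} [Field k] {n : ℕ} {q : k} {hn : 1 < n} {hq : IsPrimitiveRoot q n}
  {hodd : Odd n}

/-- Take a nonzero vector v of weight (i, j). If i ≢ j, then v and zv are nonzero of different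
weights, hence independent. If i ≡ j, then z² = ζ² on v with ζ = `zScalar n q i`, and either v or zv
- ζv spans a line stable under `z`. -/
theorem exists_injective_hom (M : FDMod k (H hn hq)) (hM : Module.finrank k M.V ≠ 0) :
    (∃ t, ∃ f : (lineMod hn hq hodd t).V →ₗ[k] M.V,
      (lineMod hn hq hodd t).IsHom M f ∧ Function.Injective f) ∨
    (∃ i j, ∃ f : (S₂ hn hq i j).V →ₗ[k] M.V, (S₂ hn hq i j).IsHom M f ∧ Function.Injective f) := by
  have : Nontrivial M.V := Module.nontrivial_of_finrank_pos (R := k) (Nat.pos_of_ne_zero hM)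
  obtain ⟨v, i, j, hv0, hv⟩ := exists_hasWeight (M := M)
  by_cases hij : i ≡ j [MOD n]
  · left
    have key : ∀ t, ∀ w : M.V, w ≠ 0 → HasWeight M w t t →
        M.act (gen hn hq .z) w = zScalar n q t • w → ∃ t, ∃ f : (lineMod hn hq hodd t).V →ₗ[k] M.V,
          (lineMod hn hq hodd t).IsHom M f ∧ Function.Injective f := by
      intro t w hw0 hw hz
      obtain ⟨f, hf, hfc⟩ := exists_hom_lineMod (hodd := hodd) M hw hz
      refine ⟨t, f, hf, (injective_iff_map_eq_zero f).2 ?_⟩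
      intro (c : k) hc
      exact (smul_eq_zero.1 ((hfc c).symm.trans hc)).resolve_right hw0
    have hv' : HasWeight M v i i := ⟨hv.x, by rw [hv.y, (pow_eq_pow_iff hn hq).2 hij]⟩
    by_cases hz : M.act (gen hn hq .z) v = zScalar n q i • v
    · exact key i v hv0 hv' hz
    -- The vector zv - ζv has z-eigenvalue -ζ. Adding the odd number n to the index keeps the weight
    -- and flips the sign.
    · have hin : i + n ≡ i [MOD n] := by simp [Nat.ModEq]
      have hpow : q ^ (i + n) = q ^ i := (pow_eq_pow_iff hn hq).2 hin
      refine key (i + n) (M.act (gen hn hq .z) v - zScalar n q i • v) (sub_ne_zero.2 hz) ⟨?_, ?_⟩ ?_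
      · rw [map_sub, map_smul, hv'.z.x, hv'.x, hpow, smul_sub, smul_comm]
      · rw [map_sub, map_smul, hv'.z.y, hv'.y, hpow, smul_sub, smul_comm]
      · have hodd' : Odd (i + n + i) := by
          obtain ⟨r, rfl⟩ := hodd
          exact ⟨i + r, by ring⟩
        rw [map_sub, map_smul, hv'.z_z, zScalar_eq_of_modEq hq hin, hodd'.neg_one_pow,
          ← zScalar_sq hq hodd]
        module
  · right
    obtain ⟨f, hf, hfc⟩ := exists_hom_S₂ M hv
    refine ⟨i, j, f, hf, (injective_iff_map_eq_zero f).2 ?_⟩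
    intro (c : Fin 2 → k) hc
    have h0 : c 0 • v + c 1 • M.act (gen hn hq .z) v = 0 := (hfc c).symm.trans hc
    have h1 : HasWeight M (c 0 • v) i j := ⟨by rw [map_smul, hv.x, smul_comm],
      by rw [map_smul, hv.y, smul_comm]⟩
    -- In a relation c₀v + c₁zv = 0 the vector c₀v = -c₁zv has both weights (i, j) and (j, i), so it
    -- vanishes.
    have h2 : HasWeight M (c 0 • v) j i := by
      rw [eq_neg_of_add_eq_zero_left h0, ← neg_smul]
      exact ⟨by rw [map_smul, hv.z.x, smul_comm], by rw [map_smul, hv.z.y, smul_comm]⟩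
    have h3 := h1.eq_zero h2 hij
    rw [h3, zero_add] at h0
    have h4 : M.act (gen hn hq .z) v ≠ 0 := by
      intro h
      have := hv.z_z
      rw [h, map_zero] at this
      exact (smul_ne_zero (pow_ne_zero _ (root_ne_zero hn hq)) hv0) this.symm
    refine funext fun a => ?_
    fin_cases a
    · exact (smul_eq_zero.1 h3).resolve_right hv0
    · exact (smul_eq_zero.1 h0).resolve_right h4

theorem cls_mem_of_simple_mem (G : AddSubgroup (GrothendieckRing k (H hn hq)))
    (hline : ∀ t, cls (lineMod hn hq hodd t) ∈ G) (hS : ∀ i j, cls (S₂ hn hq i j) ∈ G)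
    (M : FDMod k (H hn hq)) : cls M ∈ G := by
  induction hd : Module.finrank k M.V using Nat.strong_induction_on generalizing M with
  | _ d ih =>
    by_cases h0 : Module.finrank k M.V = 0
    · rw [cls_eq_zero h0]
      exact G.zero_mem
    · have key : ∀ N : FDMod k (H hn hq), cls N ∈ G → Module.finrank k N.V ≠ 0 →
          ∀ f : N.V →ₗ[k] M.V, N.IsHom M f → Function.Injective f → cls M ∈ G := by
        intro N hN hN0 f hf hinj
        obtain ⟨Q, hQ, hdim⟩ := FDMod.exists_shortExact_of_injective f hf hinj
        rw [cls_of_shortExact hQ]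
        exact G.add_mem hN (ih _ (by omega) Q rfl)
      rcases exists_injective_hom (hodd := hodd) M h0 with ⟨t, f, hf, hinj⟩ | ⟨i, j, f, hf, hinj⟩
      · exact key _ (hline t) (by rw [finrank_lineMod]; exact one_ne_zero) f hf hinj
      · exact key _ (hS i j) (by rw [finrank_S₂]; exact two_ne_zero) f hf hinj

end Generation

/-! ### Fibonacci and Lucas polynomials and the third relation -/

section Lucas

open MvPolynomial

/-- The polynomials with `L₀ = 1 + yⁿ`, `L₁ = z` and `L_{s+2} = z L_{s+1} - y L_s`. -/
noncomputable def lucas (n : ℕ) : ℕ → MvPolynomial (Fin 2) ℤ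
  | 0 => 1 + y ^ n
  | 1 => z
  | s + 2 => z * lucas n (s + 1) - y * lucas n s

theorem lucas_add_two (n s : ℕ) : lucas n (s + 2) = z * lucas n (s + 1) - y * lucas n s := rfl

theorem fib_add_two (t : ℕ) : fib (t + 2) = z * fib (t + 1) - y * fib t := rfl

theorem lucas_eq (n s : ℕ) : lucas n (s + 1) = fib (s + 2) - y ^ (n + 1) * fib s := by
  induction s using Nat.twoStepInduction with
  | zero => simp [lucas, fib]
  | one => simp [lucas, fib]; ring
  | more s h1 h2 =>
    rw [lucas_add_two, h1, h2, fib_add_two (s + 2), fib_add_two (s + 1), fib_add_two s]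
    ring

/-- The recursion is Pascal's rule for the coefficients. The truncated exponent t - 2 * i is
harmless: for 2i > t the binomial coefficient vanishes. -/
theorem fib_eq_sum (t : ℕ) : fib (t + 1) = ∑ i ∈ Finset.range (t + 1),
    (-1) ^ i * ((t - i).choose i : MvPolynomial (Fin 2) ℤ) * y ^ i * z ^ (t - 2 * i) := by
  induction t using Nat.twoStepInduction with
  | zero => simp [fib]
  | one => simp [fib, Finset.sum_range_succ]
  | more t h1 h2 =>
    have e1 : y * fib (t + 1) = ∑ i ∈ Finset.range (t + 2),
        (-1) ^ i * ((t - i).choose i : MvPolynomial (Fin 2) ℤ) * y ^ (i + 1) * z ^ (t - 2 * i) := by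
      rw [Finset.sum_range_succ, h1, Finset.mul_sum, Nat.choose_eq_zero_of_lt (by omega)]
      simp only [Nat.cast_zero, mul_zero, zero_mul, add_zero]
      exact Finset.sum_congr rfl fun i _ => by ring
    have e2 : z * fib (t + 2) = z ^ (t + 2) + ∑ i ∈ Finset.range (t + 2),
        (-1) ^ (i + 1) * ((t - i).choose (i + 1) : MvPolynomial (Fin 2) ℤ) * y ^ (i + 1) *
          z ^ (t - 2 * i) := by
      rw [h2, Finset.sum_range_succ', mul_add, add_comm, Finset.sum_range_succ _ (t + 1), Finset.mul_sum,
        Nat.choose_eq_zero_of_lt (show t - (t + 1) < t + 1 + 1 by omega)]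
      simp only [Nat.cast_zero, mul_zero, zero_mul, add_zero]
      congr 1
      · simp
        ring
      · refine Finset.sum_congr rfl fun i _ => ?_
        rw [show t + 1 - (i + 1) = t - i by omega]
        by_cases h : 2 * i + 1 ≤ t
        · rw [show t - 2 * i = (t + 1 - 2 * (i + 1)) + 1 by omega]
          ring
        · rw [Nat.choose_eq_zero_of_lt (by omega)]
          simp
    rw [fib_add_two, e1, e2, Finset.sum_range_succ' _ (t + 2), add_comm (z ^ (t + 2)), add_sub_right_comm,
      ← Finset.sum_sub_distrib]
    congr 1
    · refine Finset.sum_congr rfl fun i hi => ?_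
      have hi' := Finset.mem_range.1 hi
      rw [show t + 2 - 2 * (i + 1) = t - 2 * i by omega]
      by_cases h : i ≤ t
      · rw [show t + 2 - (i + 1) = t - i + 1 by omega, Nat.choose_succ_succ]
        push_cast
        ring
      · rw [show t + 2 - (i + 1) = 0 by omega, Nat.choose_eq_zero_of_lt (show t - i < i + 1 by omega),
          Nat.choose_eq_zero_of_lt (show t - i < i by omega),
          Nat.choose_eq_zero_of_lt (show 0 < i + 1 by omega)]
        simp
    · simp

theorem fib_eq_sum_Icc (t : ℕ) : fib (t + 1) = z ^ t + ∑ i ∈ Finset.Icc 1 (t / 2),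
    (-1) ^ i * ((t - i).choose i : MvPolynomial (Fin 2) ℤ) * y ^ i * z ^ (t - 2 * i) := by
  have h : Finset.Icc 1 (t / 2) ⊆ Finset.Ico 1 (t + 1) := fun i hi => by
    simp only [Finset.mem_Icc, Finset.mem_Ico] at hi ⊢
    omega
  rw [fib_eq_sum, Finset.range_eq_Ico, Finset.sum_eq_sum_Ico_succ_bot (Nat.succ_pos t)]
  congr 1
  · simp
  · refine (Finset.sum_subset h fun i hi hi' => ?_).symm
    simp only [Finset.mem_Icc, Finset.mem_Ico] at hi hi'
    rw [Nat.choose_eq_zero_of_lt (by omega)]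
    simp

/-- By `lucas_eq`, L_{m+1} = F_{m+2} - y^{n+1} F_m and L_m = F_{m+1} - y^{n+1} F_{m-1}. Expanding
F_{m+2} and F_{m+1} gives the powers of z and the two binomial sums; the two remaining Fibonacci
terms are left unexpanded. -/
theorem thirdRel_eq (n : ℕ) {m : ℕ} (hm : 1 ≤ m) :
    thirdRel n m = lucas n (m + 1) - y ^ (m + 1) * lucas n m := by
  obtain ⟨m, rfl⟩ := Nat.exists_eq_add_of_le' hm
  have h1 := fib_eq_sum_Icc (m + 1)
  have h2 := fib_eq_sum_Icc (m + 1 + 1)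
  rw [lucas_eq, lucas_eq, thirdRel, h2, h1, mul_sub, mul_add, Finset.mul_sum]
  have h3 : ∀ i, y ^ (m + 1 + 1) * ((-1) ^ i * ((m + 1 - i).choose i : MvPolynomial (Fin 2) ℤ) *
      y ^ i * z ^ (m + 1 - 2 * i)) = (-1) ^ i * ((m + 1 - i).choose i : MvPolynomial (Fin 2) ℤ) *
      y ^ (m + 1 + 1 + i) * z ^ (m + 1 - 2 * i) := fun i => by ring
  simp only [h3, Nat.add_sub_cancel]
  ring

end Lucas

end HTwoNSq

namespace HTwoNSq

universe u

open HopfRep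

/-! ### Additive generators of ℤ[y, z] modulo the relations -/

section Quotient

/-- Commutativity of the target is not assumed, so evaluation takes place in the subring generated
by the two elements, which is commutative. -/
theorem exists_ringHom_of_commute {R : Type*} [Ring R] {a b : R} (h : Commute a b) :
    ∃ f : MvPolynomial (Fin 2) ℤ →+* R, f y = a ∧ f z = b := by
  have hcomm : ∀ c ∈ ({a, b} : Set R), ∀ d ∈ ({a, b} : Set R), c * d = d * c := by
    rintro _ (rfl | rfl) _ (rfl | rfl)
    exacts [rfl, h.eq, h.eq.symm, rfl]
  have := Subring.isMulCommutative_closure hcomm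
  let : CommRing (Subring.closure ({a, b} : Set R)) :=
    { (inferInstance : Ring (Subring.closure ({a, b} : Set R))) with
      mul_comm := fun c d => this.is_comm.comm c d }
  let a' : Subring.closure ({a, b} : Set R) := ⟨a, Subring.subset_closure (Set.mem_insert _ _)⟩
  let b' : Subring.closure ({a, b} : Set R) :=
    ⟨b, Subring.subset_closure (Set.mem_insert_of_mem _ rfl)⟩
  let f : MvPolynomial (Fin 2) ℤ →+* Subring.closure ({a, b} : Set R) :=
    MvPolynomial.eval₂Hom (Int.castRingHom _) ![a', b']
  refine ⟨(Subring.closure ({a, b} : Set R)).subtype.comp f, ?_, ?_⟩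
  · simp [f, a', y]
  · simp [f, b', z]

variable {R : Type*} [Ring R] {n : ℕ} {f : MvPolynomial (Fin 2) ℤ →+* R}

theorem map_lucas_mul_pow (hy : f (y ^ (2 * n)) = 1) (hz : f (z * y ^ n) = f z) (s : ℕ) :
    f (lucas n s * y ^ n) = f (lucas n s) := by
  induction s using Nat.twoStepInduction with
  | zero => rw [lucas, add_mul, one_mul, ← pow_add, ← two_mul, map_add, hy, map_add, map_one,
      add_comm]
  | one => exact hz
  | more s h1 h2 =>
    rw [lucas_add_two, sub_mul, mul_assoc, mul_assoc, map_sub, map_mul, h2, map_mul, h1, map_sub,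
      map_mul, map_mul]

theorem map_pow_mul_lucas_mod (hy : f (y ^ (2 * n)) = 1) (hz : f (z * y ^ n) = f z) (i s : ℕ) :
    f (y ^ i * lucas n s) = f (y ^ (i % n) * lucas n s) := by
  have h : ∀ d, f (lucas n s * (y ^ n) ^ d) = f (lucas n s) := by
    intro d
    induction d with
    | zero => rw [pow_zero, mul_one]
    | succ d ih => rw [pow_succ', ← mul_assoc, map_mul, map_lucas_mul_pow hy hz, ← map_mul, ih]
  conv_lhs => rw [← Nat.mod_add_div i n, pow_add, pow_mul, mul_assoc, mul_comm (_ ^ (i / n)),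
    map_mul, h, ← map_mul]

theorem map_pow_mod (hy : f (y ^ (2 * n)) = 1) (t : ℕ) : f (y ^ t) = f (y ^ (t % (2 * n))) := by
  rw [map_pow, map_pow, pow_eq_pow_mod t (by rw [← map_pow, hy] : f y ^ (2 * n) = 1)]

/-- The span of the y^t and of the y^i L_s with 1 ≤ s ≤ m is stable under y, and under z because z
L_s = L_{s+1} + y L_{s-1}. At the ends of the range, L₀ = 1 + yⁿ and the third relation lead back
into the span. -/
theorem map_mem_of_basis_mem {m : ℕ}
    (h3 : f (lucas n (m + 1)) = f (y ^ (m + 1) * lucas n m)) (hm : 1 ≤ m) (G : AddSubgroup R)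
    (hG₁ : ∀ t, f (y ^ t) ∈ G) (hG₂ : ∀ i s, 1 ≤ s → s ≤ m → f (y ^ i * lucas n s) ∈ G)
    (p : MvPolynomial (Fin 2) ℤ) : f p ∈ G := by
  let B : Set (MvPolynomial (Fin 2) ℤ) :=
    {p | (∃ t, p = y ^ t) ∨ ∃ i s, 1 ≤ s ∧ s ≤ m ∧ p = y ^ i * lucas n s}
  -- Only the span K of the generators is stable under multiplication; `G` is an arbitrary additive
  -- subgroup containing them.
  let K : AddSubgroup R := AddSubgroup.closure (f '' B)
  have hK : K ≤ G := by
    rw [AddSubgroup.closure_le]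
    rintro _ ⟨p, ⟨t, rfl⟩ | ⟨i, s, h1, h2, rfl⟩, rfl⟩
    exacts [hG₁ t, hG₂ i s h1 h2]
  have hB₁ : ∀ t, f (y ^ t) ∈ K := fun t => AddSubgroup.subset_closure ⟨_, Or.inl ⟨t, rfl⟩, rfl⟩
  have hB₂ : ∀ i s, 1 ≤ s → s ≤ m → f (y ^ i * lucas n s) ∈ K := fun i s h1 h2 =>
    AddSubgroup.subset_closure ⟨_, Or.inr ⟨i, s, h1, h2, rfl⟩, rfl⟩
  have hB₃ : ∀ i s, s ≤ m + 1 → f (y ^ i * lucas n s) ∈ K := by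
    intro i s hs
    rcases Nat.eq_zero_or_pos s with rfl | h0
    · rw [lucas, mul_add, mul_one, ← pow_add, map_add]
      exact K.add_mem (hB₁ _) (hB₁ _)
    · rcases Nat.lt_or_ge m s with h | h
      · obtain rfl : s = m + 1 := by omega
        rw [map_mul, h3, ← map_mul, ← mul_assoc, ← pow_add]
        exact hB₂ _ _ hm le_rfl
      · exact hB₂ _ _ h0 h
  have hmul : ∀ (p : MvPolynomial (Fin 2) ℤ), (∀ b ∈ B, f (b * p) ∈ K) → ∀ a, f a ∈ K → f (a * p) ∈ K := by
    intro p hp a ha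
    rw [map_mul]
    generalize f a = c at ha
    induction ha using AddSubgroup.closure_induction with
    | mem x hx =>
      obtain ⟨b, hb, rfl⟩ := hx
      rw [← map_mul]
      exact hp b hb
    | zero => rw [zero_mul]; exact K.zero_mem
    | add a b _ _ ha hb => rw [add_mul]; exact K.add_mem ha hb
    | neg a _ ha => rw [neg_mul]; exact K.neg_mem ha
  apply hK
  induction p using MvPolynomial.induction_on with
  | C c =>
    have h : f (MvPolynomial.C c) = c • f (y ^ 0) := by
      rw [pow_zero, map_one, zsmul_one, ← MvPolynomial.algebraMap_eq, eq_intCast, map_intCast]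
    rw [h]
    exact K.zsmul_mem (hB₁ 0) c
  | add p r hp hr => rw [map_add]; exact K.add_mem hp hr
  | mul_X p l hp =>
    refine hmul _ ?_ p hp
    fin_cases l
    · change ∀ b ∈ B, f (b * y) ∈ K
      rintro _ (⟨t, rfl⟩ | ⟨i, s, h1, h2, rfl⟩)
      · rw [← pow_succ]
        exact hB₁ _
      · rw [mul_right_comm, ← pow_succ]
        exact hB₂ _ _ h1 h2
    · change ∀ b ∈ B, f (b * z) ∈ K
      rintro _ (⟨t, rfl⟩ | ⟨i, s, h1, h2, rfl⟩)
      · exact hB₂ t 1 le_rfl hm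
      · obtain ⟨s, rfl⟩ := Nat.exists_eq_add_of_le' h1
        have : y ^ i * lucas n (s + 1) * z =
            y ^ i * lucas n (s + 2) + y ^ (i + 1) * lucas n s := by
          rw [lucas_add_two]
          ring
        rw [this, map_add]
        exact K.add_mem (hB₃ _ _ (by omega)) (hB₃ _ _ (by omega))

end Quotient

/-! ### The isomorphism: relations, surjectivity and the left inverse -/

section Main

variable {k : Type u} [Field k] {n : ℕ} {q : k} {hn : 1 < n} {hq : IsPrimitiveRoot q n}
  {hodd : Odd n} {φ : MvPolynomial (Fin 2) ℤ →+* GrothendieckRing k (H hn hq)}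

theorem map_y_pow (hy : φ y = cls (lineMod hn hq hodd 1)) (t : ℕ) :
    φ (y ^ t) = cls (lineMod hn hq hodd t) := by
  induction t with
  | zero => rw [pow_zero, map_one, cls_lineMod_zero]
  | succ t ih => rw [pow_succ, map_mul, ih, hy, cls_lineMod_mul_cls_lineMod]

/-- The recursion is the product rule for `S₂ 0 1` and `S₂ 0 (s+1)`: its second summand is `S₂ 1
(s+1)`, the product of `lineMod 1` and `S₂ 0 s`. -/
theorem map_lucas (hy : φ y = cls (lineMod hn hq hodd 1)) (hz : φ z = cls (S₂ hn hq 0 1)) (s : ℕ) :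
    φ (lucas n s) = cls (S₂ hn hq 0 s) := by
  induction s using Nat.twoStepInduction with
  | zero => rw [lucas, map_add, map_one, map_y_pow hy, cls_S₂_zero_zero]
  | one => exact hz
  | more s h1 h2 =>
    rw [lucas_add_two, map_sub, map_mul, map_mul, h1, h2, hy, hz, cls_lineMod_mul_cls_S₂,
      cls_S₂_mul_cls_S₂, cls_S₂_comm (0 + (s + 1)), sub_eq_iff_eq_add]
    congr 2
    · congr 1; omega
    · congr 1; omega

theorem map_y_pow_mul_lucas (hy : φ y = cls (lineMod hn hq hodd 1)) (hz : φ z = cls (S₂ hn hq 0 1))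
    (i s : ℕ) : φ (y ^ i * lucas n s) = cls (S₂ hn hq i (i + s)) := by
  rw [map_mul, map_y_pow hy, map_lucas hy hz, cls_lineMod_mul_cls_S₂, add_zero]

theorem cls_S₂_eq_map (hy : φ y = cls (lineMod hn hq hodd 1)) (hz : φ z = cls (S₂ hn hq 0 1))
    (i j : ℕ) : φ (y ^ i * lucas n (j + n * i - i)) = cls (S₂ hn hq i j) := by
  -- The index j + n * i - i represents j - i mod n; adding n * i keeps the subtraction from
  -- truncating.
  have : i ≤ n * i := Nat.le_mul_of_pos_left i (by omega)
  rw [map_y_pow_mul_lucas hy hz, show i + (j + n * i - i) = j + n * i by omega]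
  exact cls_S₂_congr rfl (by simp [Nat.ModEq])

theorem map_y_pow_two_mul (hy : φ y = cls (lineMod hn hq hodd 1)) : φ (y ^ (2 * n)) = 1 := by
  have hz : zScalar n q (2 * n) = zScalar n q 0 := by
    have h : 2 * n ≡ 0 [MOD n] := by simp [Nat.ModEq]
    rw [zScalar_eq_of_modEq hq h, add_zero, pow_mul]
    simp
  have hw := hasWeight_lineMod_e (hn := hn) (hq := hq) (hodd := hodd) 0
  have hpow : q ^ (2 * n) = q ^ 0 := by rw [mul_comm, pow_mul, hq.pow_eq_one, one_pow, pow_zero]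
  rw [map_y_pow hy, ← cls_lineMod_zero (hodd := hodd)]
  refine cls_eq_of_iso (lineMod_iso_of_span (v := lineMod.e hn hq hodd 0) ⟨?_, ?_⟩ ?_
    (finrank_lineMod 0) (span_lineMod_e 0))
  · rw [hpow, hw.x]
  · rw [hpow, hw.y]
  · rw [hz, z_lineMod_e]

theorem relIdeal_le_ker (hn3 : 3 ≤ n) (hy : φ y = cls (lineMod hn hq hodd 1))
    (hz : φ z = cls (S₂ hn hq 0 1)) : relIdeal n ≤ RingHom.ker φ := by
  rw [relIdeal, Ideal.span_le]
  rintro _ (rfl | rfl | rfl)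
  · change φ _ = 0
    rw [map_sub, map_y_pow_two_mul hy, map_one, sub_self]
  · change φ _ = 0
    rw [map_sub, mul_comm, sub_eq_zero]
    have h := map_y_pow_mul_lucas hy hz n 1
    rw [lucas] at h
    rw [h, hz]
    exact cls_S₂_congr (by simp [Nat.ModEq]) (by simp [Nat.ModEq])
  · change φ _ = 0
    obtain ⟨m, rfl⟩ := hodd
    rw [show (2 * m + 1 - 1) / 2 = m by omega, thirdRel_eq _ (by omega), map_sub, map_lucas hy hz,
      map_y_pow_mul_lucas hy hz, sub_eq_zero, cls_S₂_comm]
    -- After the swap both sides have first index m + 1, and the second indices 0 and m + 1 + m = n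
    -- agree mod n.
    exact cls_S₂_congr rfl (by simp [Nat.ModEq, show m + 1 + m = 2 * m + 1 by omega])

theorem surjective_of_map (hy : φ y = cls (lineMod hn hq hodd 1)) (hz : φ z = cls (S₂ hn hq 0 1)) :
    Function.Surjective φ := by
  intro c
  have hmem : ∀ M : FDMod k (H hn hq), cls M ∈ φ.toAddMonoidHom.range :=
    cls_mem_of_simple_mem (hodd := hodd) _ (fun t => ⟨_, map_y_pow hy t⟩)
      (fun i j => ⟨_, cls_S₂_eq_map hy hz i j⟩)
  have : c ∈ φ.toAddMonoidHom.range := by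
    induction c using GrothendieckRing.induction with
    | hcls M => exact hmem M
    | hneg a ha => exact neg_mem ha
    | hadd a b ha hb => exact add_mem ha hb
    | hzero => exact zero_mem _
  exact this

/-- The map sends [M] to the sum of the spanning elements weighted by the ranks on M of the matching
idempotents. It suffices to check it on the spanning elements, where exactly one rank is 1 and the
others vanish. For `S₂` this works because n = 2m + 1: a pair of distinct residues is {i, i+s} with
1 ≤ s ≤ m for exactly one i mod n and s. -/
theorem exists_leftInverse {R : Type*} [Ring R] {m : ℕ}
    (hm : 1 ≤ m) (hnm : n = 2 * m + 1)
    (h2 : (2 : k) ≠ 0) (hφy : φ y = cls (lineMod hn hq hodd 1)) (hφz : φ z = cls (S₂ hn hq 0 1))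
    {f : MvPolynomial (Fin 2) ℤ →+* R} {ψ : R →+* GrothendieckRing k (H hn hq)}
    (hψ : ∀ p, ψ (f p) = φ p) (hy : f (y ^ (2 * n)) = 1) (hz : f (z * y ^ n) = f z)
    (h3 : f (lucas n (m + 1)) = f (y ^ (m + 1) * lucas n m)) :
    ∃ G : GrothendieckRing k (H hn hq) →+ R, ∀ p, G (φ p) = f p := by
  obtain ⟨G, hG⟩ := exists_addMonoidHom_of_additive (k := k) (H := H hn hq)
    (fun M => ∑ t ∈ Finset.range (2 * n), M.rk (eigenIdem hn hq t) • f (y ^ t) +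
      ∑ i ∈ Finset.range n, ∑ s ∈ Finset.Icc 1 m,
        M.rk (weightIdem hn hq i (i + s)) • f (y ^ i * lucas n s)) (by
    intro X Y Z h
    simp only [FDMod.rk_shortExact (weightIdem_mul_self _ _) h,
      FDMod.rk_shortExact (eigenIdem_mul_self hodd h2 _) h, add_smul, Finset.sum_add_distrib]
    abel)
  have hne : ∀ i s, 1 ≤ s → s ≤ m → ¬ i ≡ i + s [MOD n] := by
    intro i s h1 h2 h
    have h' : 0 ≡ s [MOD n] := Nat.ModEq.add_left_cancel' i h
    rw [Nat.ModEq, Nat.zero_mod, Nat.mod_eq_of_lt (by omega)] at h'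
    omega
  -- The swapped weight (i+s, i) is never of the form (j, j+r): that would force s + r ≡ 0 although
  -- 0 < s + r ≤ 2m < n.
  have hne' : ∀ i s j r, s ≤ m → 1 ≤ r → r ≤ m → i + s ≡ j [MOD n] → ¬ i ≡ j + r [MOD n] := by
    intro i s j r hs hr hr' h1 h2
    have h3 : i ≡ i + (s + r) [MOD n] := by
      rw [← add_assoc]
      exact h2.trans (h1.add_right r).symm
    have h' : 0 ≡ s + r [MOD n] := Nat.ModEq.add_left_cancel' i h3
    rw [Nat.ModEq, Nat.zero_mod, Nat.mod_eq_of_lt (by omega)] at h'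
    omega
  refine ⟨G, fun p => ?_⟩
  rw [← hψ]
  -- The elements fixed by `G` after `ψ` form an additive subgroup, so testing the spanning elements
  -- is enough.
  refine map_mem_of_basis_mem h3 hm ((G.comp ψ.toAddMonoidHom).eqLocus (AddMonoidHom.id R))
    ?_ ?_ p
  · intro t
    change G (ψ (f (y ^ t))) = f (y ^ t)
    rw [hψ, map_y_pow hφy, hG, map_pow_mod hy t, Finset.sum_eq_single (t % (2 * n)),
      rk_eigenIdem_lineMod h2, if_pos (Nat.mod_modEq t _).symm, one_smul, add_eq_left]
    · refine Finset.sum_eq_zero fun i _ => Finset.sum_eq_zero fun s hs => ?_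
      have hs' := Finset.mem_Icc.1 hs
      rw [rk_weightIdem_lineMod _ (hne i s hs'.1 hs'.2), zero_smul]
    · intro r hr hrt
      rw [rk_eigenIdem_lineMod h2, if_neg, zero_smul]
      intro h
      exact hrt ((Nat.mod_eq_of_lt (Finset.mem_range.1 hr)).symm.trans h.symm)
    · intro h
      exact absurd (Finset.mem_range.2 (Nat.mod_lt _ (by omega))) h
  · intro i s hs1 hs2
    change G (ψ (f (y ^ i * lucas n s))) = f (y ^ i * lucas n s)
    rw [hψ, map_y_pow_mul_lucas hφy hφz, hG, map_pow_mul_lucas_mod hy hz i s,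
      Finset.sum_eq_zero, zero_add, Finset.sum_eq_single (i % n), Finset.sum_eq_single s,
      rk_weightIdem_S₂, if_pos, if_neg, add_zero, one_smul]
    · exact fun h => hne' i s (i % n) s hs2 hs1 hs2 h.1 h.2
    · exact ⟨(Nat.mod_modEq i n).symm, (Nat.mod_modEq i n).symm.add_right s⟩
    · intro r hr hrs
      have hr' := Finset.mem_Icc.1 hr
      rw [rk_weightIdem_S₂, if_neg, if_neg, add_zero, zero_smul]
      · exact fun h => hne' i s (i % n) r hs2 hr'.1 hr'.2 h.1 h.2
      · intro h
        have h' : s ≡ r [MOD n] := Nat.ModEq.add_left_cancel h.1 h.2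
        rw [Nat.ModEq, Nat.mod_eq_of_lt (by omega), Nat.mod_eq_of_lt (by omega)] at h'
        exact hrs h'.symm
    · intro h
      exact absurd (Finset.mem_Icc.2 ⟨hs1, hs2⟩) h
    · intro j hj hji
      refine Finset.sum_eq_zero fun r hr => ?_
      have hr' := Finset.mem_Icc.1 hr
      rw [rk_weightIdem_S₂, if_neg, if_neg, add_zero, zero_smul]
      · exact fun h => hne' i s j r hs2 hr'.1 hr'.2 h.1 h.2
      · intro h
        exact hji ((Nat.mod_eq_of_lt (Finset.mem_range.1 hj)).symm.trans h.1.symm)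
    · intro h
      exact absurd (Finset.mem_range.2 (Nat.mod_lt _ (by omega))) h
    · intro t _
      rw [rk_eigenIdem_S₂ _ (hne i s hs1 hs2), zero_smul]

theorem two_ne_zero_of_not_ringChar_dvd (h : ¬ ringChar k ∣ 2 * n ^ 2) : (2 : k) ≠ 0 := by
  intro h2
  apply h
  apply Dvd.dvd.mul_right
  exact (ringChar.spec k 2).1 (by exact_mod_cast h2)

end Main

end HTwoNSq

theorem mainTheorem1 {k : Type*} [Field k] {n : ℕ} (hn : 1 < n) (hn3 : 3 ≤ n) (hodd : Odd n)
    (hchar : ¬ ringChar k ∣ 2 * n ^ 2) {q : k} (hq : IsPrimitiveRoot q n) :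
    ∃ Φ : (MvPolynomial (Fin 2) ℤ ⧸ HTwoNSq.relIdeal n) ≃+*
        HopfRep.GrothendieckRing k (HTwoNSq.H hn hq),
      Φ (Ideal.Quotient.mk (HTwoNSq.relIdeal n) HTwoNSq.y) =
          HopfRep.cls (HTwoNSq.S hn hq hodd (n + 1)) ∧
        Φ (Ideal.Quotient.mk (HTwoNSq.relIdeal n) HTwoNSq.z) =
          HopfRep.cls (HTwoNSq.S₂ hn hq 0 1) := by
  obtain ⟨φ, hφy, hφz⟩ := HTwoNSq.exists_ringHom_of_commute
    (a := HopfRep.cls (HTwoNSq.lineMod hn hq hodd 1)) (b := HopfRep.cls (HTwoNSq.S₂ hn hq 0 1)) (by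
      rw [Commute, SemiconjBy, HTwoNSq.cls_lineMod_mul_cls_S₂, HTwoNSq.cls_S₂_mul_cls_lineMod])
  have hker := HTwoNSq.relIdeal_le_ker hn3 hφy hφz
  let ψ := Ideal.Quotient.lift (HTwoNSq.relIdeal n) φ fun a ha => hker ha
  have hmem : ∀ {a b : MvPolynomial (Fin 2) ℤ}, a - b ∈ HTwoNSq.relIdeal n →
      Ideal.Quotient.mk (HTwoNSq.relIdeal n) a = Ideal.Quotient.mk (HTwoNSq.relIdeal n) b :=
    fun h => Ideal.Quotient.eq.2 h
  obtain ⟨m, hm⟩ := id hodd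
  have hm1 : 1 ≤ m := by omega
  obtain ⟨G, hG⟩ := HTwoNSq.exists_leftInverse (R := MvPolynomial (Fin 2) ℤ ⧸ HTwoNSq.relIdeal n)
    (f := Ideal.Quotient.mk _) (ψ := ψ) hm1 hm
    (HTwoNSq.two_ne_zero_of_not_ringChar_dvd hchar) hφy hφz (fun _ => rfl)
    (by
      rw [← map_one (Ideal.Quotient.mk (HTwoNSq.relIdeal n))]
      exact hmem (Ideal.subset_span (Or.inl rfl)))
    (hmem (Ideal.subset_span (Or.inr (Or.inl rfl))))
    (by
      apply hmem
      rw [← HTwoNSq.thirdRel_eq n hm1, show m = (n - 1) / 2 by omega]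
      exact Ideal.subset_span (Or.inr (Or.inr rfl)))
  have hbij : Function.Bijective ψ := by
    constructor
    -- `G` is merely additive, but a set-theoretic left inverse already gives injectivity of the
    -- ring map.
    · refine Function.LeftInverse.injective (g := G) fun a => ?_
      obtain ⟨p, rfl⟩ := Ideal.Quotient.mk_surjective a
      exact hG p
    · exact Ideal.Quotient.lift_surjective_of_surjective _ _
        (HTwoNSq.surjective_of_map hφy hφz)
  refine ⟨RingEquiv.ofBijective ψ hbij, ?_, hφz⟩
  rw [HTwoNSq.cls_S_succ hn3]
  exact hφy
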